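/- **Setting.** Work with finite structures with one binary relation (finite digraphs, loops allowed; finite graphs are the special case of a symmetric irreflexive relation). For positive integers $c,k$, let $\mathcal F_k^{(c)}$ be the family of the $c$ monochromatic $k$-cliques, i.e. of all pairs $(\mathbb K_k, f)$ where $\mathbb K_k$ is the complete graph on $k$ vertices and $f$ is a constant map $K_k\to[c]$. For a finite family $\mathcal F$ of pairs $(\mathbb F,f)$ with $f\colon F\to[c]$, a colouring $g\colon I\to[c]$ of a structure $\mathbb I$ is *$\mathcal F$-free* if $f\neq g\circ h$ for all $(\mathbb F,f)\in\mathcal F$ and all homomorphisms $h\colon\mathbb F\to\mathbb I$. For families $\mathcal F,\mathcal G$ with colour sets $[c],[d]$, a *recolouring* from $\mathcal F$ to $\mathcal G$ is a map $r\colon[c]\to[d]$ such that for no $(\mathbb G,f)\in\mathcal G$ there is an $\mathcal F$-free colouring $g$ of $\mathbb G$ with $r\circ g=f$; write $\mathcal F\to\mathcal G$ if one exists. If $\mathcal F\to\mathcal G$, the problem $\mathrm{PMMSNP}(\mathcal F,\mathcal G)$ has two versions. Decision: given a finite structure $\mathbb I$, answer Yes if $\mathbb I$ has an $\mathcal F$-free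 colouring, and No if $\mathbb I$ has no $\mathcal G$-free colouring (any answer is allowed otherwise). Search: given a finite structure $\mathbb I$ promised to have an $\mathcal F$-free colouring, output a $\mathcal G$-free colouring of $\mathbb I$. **Theorem.** Let $c,d,k,\ell$ be positive integers that satisfy the containment condition $$k\le\left\lceil \frac{\ell}{\lceil c/d\rceil}\right\rceil$$ and such that $\ell\ge c(k-1)$. Then $\mathcal F_k^{(c)}\to\mathcal F_\ell^{(d)}$, and $\mathrm{PMMSNP}(\mathcal F_k^{(c)},\mathcal F_\ell^{(d)})$ is solvable in polynomial time, in its decision version (it is in P) and in its search version, where $c,d,k,\ell$ are fixed and the input is a structure given by its size in unary and its adjacency matrix. -/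

import Mathlib

open FirstOrder

noncomputable section

/-! ### Finite relational structures, colourings and forbidden patterns -/

/-- A finite structure over the language `L`; up to isomorphism its domain is `Fin size`. -/
structure FinStructure (L : FirstOrder.Language.{0, 0}) where
  size : ℕ
  str : L.Structure (Fin size)

attribute [instance] FinStructure.str

/-- A forbidden pattern with colour set `[c]`: a finite structure together with a colouring. -/
structure ForbiddenPattern (L : FirstOrder.Language.{0, 0}) (c : ℕ) where
  base : FinStructure L
  colour : Fin base.size → Fin c

/-- A finite family of forbidden patterns over the same language, with colour set `[c]`. -/
structure PatternFamily (L : FirstOrder.Language.{0, 0}) (c : ℕ) where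
  patterns : Set (ForbiddenPattern L c)
  finite : patterns.Finite

/-- The `c`-expansion `(I, g)` is `F`-free: every homomorphism `h` from the structure of a
forbidden pattern `(P, f)` to `I` satisfies `f ≠ g ∘ h`. -/
def IsFree {L : FirstOrder.Language.{0, 0}} {c : ℕ} (F : PatternFamily L c) (I : FinStructure L)
    (g : Fin I.size → Fin c) : Prop :=
  ∀ p ∈ F.patterns, ∀ h : Fin p.base.size →[L] Fin I.size, p.colour ≠ g ∘ h

/-- `r : [c] → [d]` is a recolouring from `F` to `G`: no forbidden pattern `(P, f)` of `G` has
an `F`-free `r`-preimage, that is, an `F`-free expansion `(P, g)` with `r ∘ g = f`. -/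
def IsRecolouring {L : FirstOrder.Language.{0, 0}} {c d : ℕ} (F : PatternFamily L c) (G : PatternFamily L d)
    (r : Fin c → Fin d) : Prop :=
  ∀ p ∈ G.patterns, ¬ ∃ g : Fin p.base.size → Fin c, r ∘ g = p.colour ∧ IsFree F p.base g

/-- `F → G`: there is a recolouring from `F` to `G`. -/
def Recolourable {L : FirstOrder.Language.{0, 0}} {c d : ℕ} (F : PatternFamily L c)
    (G : PatternFamily L d) : Prop :=
  ∃ r : Fin c → Fin d, IsRecolouring F G r

/-! ### Promise problems and polynomial time -/

/-- A promise decision problem: the instances to be accepted and those to be rejected. -/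
structure PromiseProblem (α : Type) where
  yes : Set α
  no : Set α

/-- A promise search problem: the promised instances and, for each instance, its solutions. -/
structure PromiseSearch (α β : Type) where
  promise : Set α
  solutions : α → Set β

/-- `f` is computable in polynomial time by a (multi-stack) Turing machine, where inputs and
outputs are written by means of the encodings `ea` and `eb`. -/
def PolyTime {α β A B : Type} (ea : α → List A) (eb : β → List B) (f : α → β) : Prop :=
  Nonempty (Turing.TM2ComputableInPolyTime ea eb f)

/-- The promise decision problem `P` is in P: some polynomial-time algorithm accepts all yes
instances and rejects all no instances. -/
def PromiseProblem.InP {α A : Type} (ea : α → List A) (P : PromiseProblem α) : Prop :=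
  ∃ f : α → Bool, PolyTime ea Computability.encodeBool f ∧
    (∀ x ∈ P.yes, f x = true) ∧ (∀ x ∈ P.no, f x = false)

/-- The promise search problem `S` is solvable in polynomial time: some polynomial-time
algorithm outputs a solution on every instance that fulfils the promise. -/
def PromiseSearch.InP {α β A B : Type} (ea : α → List A) (eb : β → List B)
    (S : PromiseSearch α β) : Prop :=
  ∃ f : α → β, PolyTime ea eb f ∧ ∀ x ∈ S.promise, f x ∈ S.solutions x

/-! ### Promise MMSNP -/

/-- The decision version of `PMMSNP(F, G)`. -/
def pmmsnpDecision {L : FirstOrder.Language.{0, 0}} {c d : ℕ} (F : PatternFamily L c)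
    (G : PatternFamily L d) : PromiseProblem (FinStructure L) where
  yes := {I | ∃ g : Fin I.size → Fin c, IsFree F I g}
  no := {I | ¬ ∃ g : Fin I.size → Fin d, IsFree G I g}

/-- The search version of `PMMSNP(F, G)`. A colouring `g` of a structure with domain
`{0, …, n - 1}` is output as the list `g 0, …, g (n - 1)` of its values. -/
def pmmsnpSearch {L : FirstOrder.Language.{0, 0}} {c d : ℕ} (F : PatternFamily L c)
    (G : PatternFamily L d) : PromiseSearch (FinStructure L) (List (Fin d)) where
  promise := {I | ∃ g : Fin I.size → Fin c, IsFree F I g}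
  solutions I := {w | ∃ g : Fin I.size → Fin d, IsFree G I g ∧ w = List.ofFn g}

/-! ### Monochromatic cliques -/

/-- The `k`-clique, as a structure with one binary relation (adjacency). -/
def cliqueStructure (k : ℕ) : FinStructure FirstOrder.Language.graph where
  size := k
  str := (⊤ : SimpleGraph (Fin k)).structure

/-- The family of all monochromatic `k`-cliques, in one of `c` colours. -/
def cliqueFamily (c k : ℕ) : PatternFamily FirstOrder.Language.graph c where
  patterns := Set.range fun a : Fin c => ⟨cliqueStructure k, fun _ => a⟩
  finite := Set.finite_range _

open Classical in
/-- The encoding of a structure with one binary relation as a bit string: its size `n` in unary,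
a separating `0`, and the `n × n` adjacency matrix, row by row. -/
def encodeGraph (I : FinStructure FirstOrder.Language.graph) : List Bool :=
  List.replicate I.size true ++ false ::
    (List.finRange I.size).flatMap fun i => (List.finRange I.size).map fun j =>
      decide (FirstOrder.Language.Structure.RelMap FirstOrder.Language.adj ![i, j])

/-- The containment condition `k ≤ ⌈ℓ / ⌈c / d⌉⌉`. -/
def ContainmentCondition (c d k l : ℕ) : Prop :=
  k ≤ ⌈(l : ℚ) / (⌈(c : ℚ) / (d : ℚ)⌉₊ : ℚ)⌉₊

end

/-! Consider a colouring free of monochromatic `k`-cliques and a homomorphic image of the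
`ℓ`-clique, that is, an `ℓ`-tuple of pairwise adjacent vertices. Each of the `c` colours occurs at
most `k - 1` times on it, so `ℓ ≤ c (k - 1)` (`size_clique_le`). If `ℓ > c (k - 1)`, promised
instances therefore contain no such tuple at all, every colouring is a solution, and searching for a
tuple decides the problem.

Let `ℓ = c (k - 1)`. Then every colour occurs exactly `k - 1` times on each tuple. Nonzero weights
of sum zero on the colours turn the unknown colouring into a vector `y`, zero at no vertex, whose
sum along every tuple is zero (`sum_colour_eq_zero`). This is a linear condition `B y = 0`, where
the rows of `B` are the occurrence vectors of the tuples. Let `N` be a nonzero multiple of the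
orthogonal projection onto the kernel of `M = Bᵀ B`, which is also the kernel of `B`. As `N y` is a
nonzero multiple of `y`, no row of `N` vanishes. As the columns of `N` lie in the kernel, the rows
of `N` sum to zero along each tuple. Colour a vertex by the sign of the last nonzero entry of its
row. On a given tuple, the last column in which some row of the tuple is nonzero has sum zero, hence
a positive and a negative entry, so both signs occur (`exists_rowSign`). Two colours are available:
with equality, the containment condition forces `d ≥ 2` (`two_le_of_containment`). The decision
version checks whether the computed signs are indeed both present on all tuples.

The matrix `N` comes from a division-free form of the Faddeev-LeVerrier recursion, stopped when the
next matrix would have trace zero (`TraceMethod.iterate_step`). It needs only sums, products and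
comparisons of natural numbers if matrices are stored as differences, and the number of digits grows
by a linear amount per step.

The recolouring merges blocks of `⌈c / d⌉` colours; it works by the same pigeonhole count.

For polynomial time, the structured stack programs `Cmd` are compiled to multi-stack machines
(`Exec.simulate`). The class `Feasible` of functions computed by such programs on binary trees is
closed under composition, pairing, case distinction and folds with polynomially bounded states. The
algorithm is written with lists and binary numbers and stays inside this class. -/

/-! ### A structured language for programs on stacks -/

/-- The stacks that a program can read. -/
inductive WorkStack
  | main | aux₁ | aux₂ | aux₃ | count | flag | input
  deriving DecidableEq

instance : Fintype WorkStack :=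
  ⟨{.main, .aux₁, .aux₂, .aux₃, .count, .flag, .input}, fun w => by cases w <;> decide⟩

/-- The contents of all stacks; `output` can only be written. -/
structure Stacks where
  main : List Bool
  aux₁ : List Bool
  aux₂ : List Bool
  aux₃ : List Bool
  count : List Bool
  flag : List Bool
  input : List Bool
  output : List Bool

namespace Stacks

/-- The content of a readable stack. -/
def get (s : Stacks) : WorkStack → List Bool
  | .main => s.main
  | .aux₁ => s.aux₁
  | .aux₂ => s.aux₂
  | .aux₃ => s.aux₃
  | .count => s.count
  | .flag => s.flag
  | .input => s.input

/-- Replace the content of a readable stack. -/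
def set (s : Stacks) (w : WorkStack) (l : List Bool) : Stacks :=
  match w with
  | .main => { s with main := l }
  | .aux₁ => { s with aux₁ := l }
  | .aux₂ => { s with aux₂ := l }
  | .aux₃ => { s with aux₃ := l }
  | .count => { s with count := l }
  | .flag => { s with flag := l }
  | .input => { s with input := l }

end Stacks

/-- Structured programs on stacks. The command `pop w c₀ c₁ c₂` pops `w` and continues with `c₀`,
`c₁` or `c₂` if `w` was empty, had top `false`, or had top `true`; the command `loop w c₁ c₂` pops
`w` until it is empty, running `c₁` or `c₂` after each symbol. -/
inductive Cmd
  | skip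
  | push (w : WorkStack) (b : Bool)
  | emit (b : Bool)
  | seq (c₁ c₂ : Cmd)
  | pop (w : WorkStack) (c₀ c₁ c₂ : Cmd)
  | loop (w : WorkStack) (c₁ c₂ : Cmd)

infixr:67 " ;; " => Cmd.seq

/-- `Exec c s t s'`: started with the stacks `s`, the program `c` halts within `t` steps with the
stacks `s'`. -/
inductive Exec : Cmd → Stacks → ℕ → Stacks → Prop
  | skip {s} : Exec .skip s 0 s
  | push {s w b} : Exec (.push w b) s 1 (s.set w (b :: s.get w))
  | emit {s b} : Exec (.emit b) s 1 { s with output := b :: s.output }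
  | seq {c₁ c₂ s₁ s₂ s₃ t₁ t₂} : Exec c₁ s₁ t₁ s₂ → Exec c₂ s₂ t₂ s₃ →
      Exec (c₁ ;; c₂) s₁ (t₁ + t₂) s₃
  | popNil {w c₀ c₁ c₂ s t s'} : s.get w = [] → Exec c₀ s t s' →
      Exec (.pop w c₀ c₁ c₂) s (t + 1) s'
  | popFalse {w c₀ c₁ c₂ s l t s'} : s.get w = false :: l → Exec c₁ (s.set w l) t s' →
      Exec (.pop w c₀ c₁ c₂) s (t + 1) s'
  | popTrue {w c₀ c₁ c₂ s l t s'} : s.get w = true :: l → Exec c₂ (s.set w l) t s' →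
      Exec (.pop w c₀ c₁ c₂) s (t + 1) s'
  | loopNil {w c₁ c₂ s} : s.get w = [] → Exec (.loop w c₁ c₂) s 1 s
  | loopFalse {w c₁ c₂ s l t s' t' s''} : s.get w = false :: l → Exec c₁ (s.set w l) t s' →
      Exec (.loop w c₁ c₂) s' t' s'' → Exec (.loop w c₁ c₂) s (t + t' + 1) s''
  | loopTrue {w c₁ c₂ s l t s' t' s''} : s.get w = true :: l → Exec c₂ (s.set w l) t s' →
      Exec (.loop w c₁ c₂) s' t' s'' → Exec (.loop w c₁ c₂) s (t + t' + 1) s''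
  | mono {c s t t' s'} : Exec c s t s' → t ≤ t' → Exec c s t' s'

/-- Each step of a program lengthens a stack by at most one. -/
theorem Exec.length_main_le {c : Cmd} {s s' : Stacks} {t : ℕ} (h : Exec c s t s') :
    s'.main.length ≤ s.main.length + t := by
  have key : ∀ (s : Stacks) (w : WorkStack) (b : Bool) (l : List Bool), s.get w = b :: l →
      (s.set w l).main.length ≤ s.main.length := by
    intro s w b l h
    cases w <;> simp_all [Stacks.get, Stacks.set]
  induction h with
  | @push s w b => cases w <;> simp [Stacks.get, Stacks.set]
  | popFalse h _ ih => have := key _ _ _ _ h; omega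
  | popTrue h _ ih => have := key _ _ _ _ h; omega
  | loopFalse h _ _ ih => have := key _ _ _ _ h; omega
  | loopTrue h _ _ ih => have := key _ _ _ _ h; omega
  | skip => simp
  | emit => simp
  | _ => omega

/-! ### Compilation to Turing machines with several stacks -/

namespace Cmd

/-- The program points of a command. -/
def Label : Cmd → Type
  | skip => Empty
  | push _ _ => Unit
  | emit _ => Unit
  | seq c₁ c₂ => c₁.Label ⊕ c₂.Label
  | pop _ c₀ c₁ c₂ => Unit ⊕ c₀.Label ⊕ c₁.Label ⊕ c₂.Label
  | loop _ c₁ c₂ => Unit ⊕ c₁.Label ⊕ c₂.Label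

/-- A command has finitely many program points. -/
@[reducible]
def labelFintype : (c : Cmd) → Fintype c.Label
  | skip => inferInstanceAs (Fintype Empty)
  | push _ _ => inferInstanceAs (Fintype Unit)
  | emit _ => inferInstanceAs (Fintype Unit)
  | seq c₁ c₂ =>
    letI := c₁.labelFintype
    letI := c₂.labelFintype
    inferInstanceAs (Fintype (c₁.Label ⊕ c₂.Label))
  | pop _ c₀ c₁ c₂ =>
    letI := c₀.labelFintype
    letI := c₁.labelFintype
    letI := c₂.labelFintype
    inferInstanceAs (Fintype (Unit ⊕ c₀.Label ⊕ c₁.Label ⊕ c₂.Label))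
  | loop _ c₁ c₂ =>
    letI := c₁.labelFintype
    letI := c₂.labelFintype
    inferInstanceAs (Fintype (Unit ⊕ c₁.Label ⊕ c₂.Label))

variable {L : Type}

/-- The entry point of a command whose program points are embedded by `e` and whose exit is `x`. -/
def entry : (c : Cmd) → (e : c.Label → L) → (x : L) → L
  | skip, _, x => x
  | push _ _, e, _ => e ()
  | emit _, e, _ => e ()
  | seq c₁ c₂, e, x => c₁.entry (e ∘ .inl) (c₂.entry (e ∘ .inr) x)
  | pop _ _ _ _, e, _ => e (.inl ())
  | loop _ _ _, e, _ => e (.inl ())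

/-- The alphabets: the output stack `none` has the alphabet `B`, all others hold Booleans. -/
def Alphabet (B : Type) : Option WorkStack → Type
  | none => B
  | some _ => Bool

variable {B : Type}

/-- Three-way branching on the last symbol that was popped. -/
def branch {α : Type} (a₀ a₁ a₂ : α) : Option Bool → α
  | none => a₀
  | some false => a₁
  | some true => a₂

/-- The statement of a multi-stack machine at each program point of a command. -/
def stmt (φ : Bool → B) : (c : Cmd) → (e : c.Label → L) → (x : L) → c.Label →
    Turing.TM2.Stmt (Alphabet B) L (Option Bool)
  | skip, _, _, l => nomatch l
  | push w b, _, x, _ => .push (some w) (fun _ => b) (.goto fun _ => x)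
  | emit b, _, x, _ => .push none (fun _ => φ b) (.goto fun _ => x)
  | seq c₁ c₂, e, x, .inl l => c₁.stmt φ (e ∘ .inl) (c₂.entry (e ∘ .inr) x) l
  | seq _ c₂, e, x, .inr l => c₂.stmt φ (e ∘ .inr) x l
  | pop w c₀ c₁ c₂, e, x, .inl _ => .pop (some w) (fun _ o => o) (.goto (branch
      (c₀.entry (e ∘ .inr ∘ .inl) x) (c₁.entry (e ∘ .inr ∘ .inr ∘ .inl) x)
      (c₂.entry (e ∘ .inr ∘ .inr ∘ .inr) x)))
  | pop _ c₀ _ _, e, x, .inr (.inl l) => c₀.stmt φ (e ∘ .inr ∘ .inl) x l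
  | pop _ _ c₁ _, e, x, .inr (.inr (.inl l)) => c₁.stmt φ (e ∘ .inr ∘ .inr ∘ .inl) x l
  | pop _ _ _ c₂, e, x, .inr (.inr (.inr l)) => c₂.stmt φ (e ∘ .inr ∘ .inr ∘ .inr) x l
  | loop w c₁ c₂, e, x, .inl _ => .pop (some w) (fun _ o => o) (.goto (branch x
      (c₁.entry (e ∘ .inr ∘ .inl) (e (.inl ()))) (c₂.entry (e ∘ .inr ∘ .inr) (e (.inl ())))))
  | loop _ c₁ _, e, _, .inr (.inl l) => c₁.stmt φ (e ∘ .inr ∘ .inl) (e (.inl ())) l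
  | loop _ _ c₂, e, _, .inr (.inr l) => c₂.stmt φ (e ∘ .inr ∘ .inr) (e (.inl ())) l

end Cmd

/-- The stacks of the machine. -/
def Stacks.toMachine {B : Type} (φ : Bool → B) (s : Stacks) : ∀ k, List (Cmd.Alphabet B k)
  | none => s.output.map φ
  | some w => s.get w

theorem Stacks.toMachine_set {B : Type} (φ : Bool → B) (s : Stacks) (w : WorkStack)
    (l : List Bool) :
    (s.set w l).toMachine φ = Function.update (s.toMachine φ) (some w) l := by
  funext k
  rcases k with _ | v
  · cases w <;> rfl
  · cases w <;> cases v <;> rfl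

theorem Stacks.toMachine_emit {B : Type} (φ : Bool → B) (s : Stacks) (b : Bool) :
    ({ s with output := b :: s.output } : Stacks).toMachine φ =
      Function.update (s.toMachine φ) none (φ b :: s.output.map φ) := by
  funext k
  rcases k with _ | v
  · rfl
  · cases v <;> rfl

/-- `IterStep f n a b`: `n` steps of `f` lead from `a` to `b`. -/
def IterStep {α : Type} (f : α → Option α) (n : ℕ) (a b : α) : Prop :=
  (flip bind f)^[n] (some a) = some b

theorem IterStep.trans {α : Type} {f : α → Option α} {m n : ℕ} {a b c : α}
    (h₁ : IterStep f m a b) (h₂ : IterStep f n b c) : IterStep f (m + n) a c := by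
  unfold IterStep at *
  rw [Nat.add_comm, Function.iterate_add_apply, h₁, h₂]

theorem IterStep.one {α : Type} {f : α → Option α} {a b : α} (h : f a = some b) :
    IterStep f 1 a b := h

open Turing.TM2 in
/-- Compiled commands simulate the commands. -/
theorem Exec.simulate {B L : Type} (φ : Bool → B)
    (m : L → Turing.TM2.Stmt (Cmd.Alphabet B) L (Option Bool)) {c : Cmd} {s s' : Stacks} {t : ℕ}
    (h : Exec c s t s') : ∀ (e : c.Label → L) (x : L), (∀ l, m (e l) = c.stmt φ e x l) →
      ∀ v, ∃ n ≤ t, ∃ v', IterStep (step m) n ⟨some (c.entry e x), v, s.toMachine φ⟩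
        ⟨some x, v', s'.toMachine φ⟩ := by
  -- The popped symbol, or `none` for an empty stack, becomes the internal state, on which the
  -- following jump branches. This is the only use of the internal state.
  have hpop : ∀ (w : WorkStack) (s : Stacks) (e : L) (g : Option Bool → L),
      m e = .pop (some w) (fun _ o => o) (.goto g) → ∀ v, IterStep (step m) 1
        ⟨some e, v, s.toMachine φ⟩
        ⟨some (g (s.get w).head?), (s.get w).head?, (s.set w (s.get w).tail).toMachine φ⟩ := by
    intro w s e g h v
    apply IterStep.one
    simp only [step, h, stepAux, Stacks.toMachine_set]
    rfl
  have hset : ∀ (s : Stacks) (w : WorkStack), s.set w (s.get w) = s := by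
    intro s w; cases w <;> rfl
  induction h with
  | skip => exact fun e x _ v => ⟨0, le_rfl, v, rfl⟩
  | push =>
    intro e x he v
    refine ⟨1, le_rfl, v, IterStep.one ?_⟩
    simp only [step, Cmd.entry, he (), Cmd.stmt, stepAux, Stacks.toMachine_set]
    rfl
  | emit =>
    intro e x he v
    refine ⟨1, le_rfl, v, IterStep.one ?_⟩
    simp only [step, Cmd.entry, he (), Cmd.stmt, stepAux, Stacks.toMachine_emit]
    rfl
  | seq _ _ ih₁ ih₂ =>
    intro e x he v
    obtain ⟨n₁, h₁, v₁, H₁⟩ := ih₁ (e ∘ .inl) _ (fun l => he (.inl l)) v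
    obtain ⟨n₂, h₂, v₂, H₂⟩ := ih₂ (e ∘ .inr) x (fun l => he (.inr l)) v₁
    exact ⟨n₁ + n₂, by omega, v₂, H₁.trans H₂⟩
  | @popNil w c₀ c₁ c₂ s _ _ hw _ ih =>
    intro e x he v
    have H := hpop w s _ _ (he (.inl ())) v
    have hs : s.set w [] = s := by rw [← hw, hset]
    rw [hw, List.tail_nil, hs] at H
    obtain ⟨n, hn, v', H'⟩ := ih (e ∘ .inr ∘ .inl) x (fun l => he (.inr (.inl l))) none
    exact ⟨1 + n, by omega, v', H.trans H'⟩
  | @popFalse w c₀ c₁ c₂ s _ _ _ hw _ ih =>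
    intro e x he v
    have H := hpop w s _ _ (he (.inl ())) v
    rw [hw] at H
    obtain ⟨n, hn, v', H'⟩ := ih (e ∘ .inr ∘ .inr ∘ .inl) x
      (fun l => he (.inr (.inr (.inl l)))) (some false)
    exact ⟨1 + n, by omega, v', H.trans H'⟩
  | @popTrue w c₀ c₁ c₂ s _ _ _ hw _ ih =>
    intro e x he v
    have H := hpop w s _ _ (he (.inl ())) v
    rw [hw] at H
    obtain ⟨n, hn, v', H'⟩ := ih (e ∘ .inr ∘ .inr ∘ .inr) x
      (fun l => he (.inr (.inr (.inr l)))) (some true)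
    exact ⟨1 + n, by omega, v', H.trans H'⟩
  | @loopNil w c₁ c₂ s hw =>
    intro e x he v
    have H := hpop w s _ _ (he (.inl ())) v
    have hs : s.set w [] = s := by rw [← hw, hset]
    rw [hw, List.tail_nil, hs] at H
    exact ⟨1, le_rfl, _, H⟩
  | @loopFalse w c₁ c₂ s _ _ _ _ _ hw _ _ ih ih' =>
    intro e x he v
    have H := hpop w s _ _ (he (.inl ())) v
    rw [hw] at H
    obtain ⟨n, hn, v', H'⟩ := ih (e ∘ .inr ∘ .inl) (e (.inl ()))
      (fun l => he (.inr (.inl l))) (some false)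
    obtain ⟨n', hn', v'', H''⟩ := ih' e x he v'
    exact ⟨1 + n + n', by omega, v'', (H.trans H').trans H''⟩
  | @loopTrue w c₁ c₂ s _ _ _ _ _ hw _ _ ih ih' =>
    intro e x he v
    have H := hpop w s _ _ (he (.inl ())) v
    rw [hw] at H
    obtain ⟨n, hn, v', H'⟩ := ih (e ∘ .inr ∘ .inr) (e (.inl ()))
      (fun l => he (.inr (.inr l))) (some true)
    obtain ⟨n', hn', v'', H''⟩ := ih' e x he v'
    exact ⟨1 + n + n', by omega, v'', (H.trans H').trans H''⟩
  | mono _ hle ih =>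
    intro e x he v
    obtain ⟨n, hn, H⟩ := ih e x he v
    exact ⟨n, hn.trans hle, H⟩

/-- The machine that runs a command and then halts. -/
def Cmd.machine {B : Type} (φ : Bool → B) (c : Cmd) : Turing.FinTM2 where
  K := Option WorkStack
  k₀ := some .input
  k₁ := none
  Γ := Cmd.Alphabet B
  Λ := Option c.Label
  main := c.entry some none
  ΛFin := letI := c.labelFintype; inferInstance
  σ := Option Bool
  initialState := none
  Γk₀Fin := inferInstanceAs (Fintype Bool)
  m
    -- The exit label resets the internal state, because a halting configuration is required to
    -- carry the initial one. This costs the additional step in the time bound `p + 1`.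
    | none => .load (fun _ => none) .halt
    | some l => c.stmt φ some none l

/-- A command that turns its input into its output in polynomial time gives a polynomial-time
Turing machine. -/
theorem polyTime_of_exec {α β B : Type} {ea : α → List Bool} {eb : β → List B} {g : α → β}
    (φ : Bool → B) (c : Cmd) (p : Polynomial ℕ) (out : α → List Bool)
    (hout : ∀ a, (out a).map φ = eb (g a))
    (h : ∀ a, Exec c ⟨[], [], [], [], [], [], ea a, []⟩ (p.eval (ea a).length)
      ⟨[], [], [], [], [], [], [], out a⟩) : PolyTime ea eb g := by
  refine ⟨⟨⟨c.machine φ, Equiv.refl Bool, Equiv.refl B⟩, p + 1, fun a => ?_⟩⟩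
  have hsim := (h a).simulate φ (c.machine φ).m some none (fun _ => rfl) none
  have h' : ∃ n ≤ p.eval (ea a).length + 1, IterStep (c.machine φ).step n
      (Turing.initList (c.machine φ) ((ea a).map (Equiv.refl Bool).invFun))
      (Turing.haltList (c.machine φ) ((eb (g a)).map (Equiv.refl B).invFun)) := by
    obtain ⟨n, hn, v', H⟩ := hsim
    have hi : ∀ l : List Bool, Turing.initList (c.machine φ) l =
        ⟨some (c.entry some none), none, (Stacks.mk [] [] [] [] [] [] l []).toMachine φ⟩ := by
      intro l
      unfold Turing.initList
      congr 1
      funext k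
      rcases k with _ | w
      · rfl
      · cases w <;> rfl
    have hf : ∀ l : List Bool, Turing.haltList (c.machine φ) (l.map φ : List B) =
        ⟨none, none, (Stacks.mk [] [] [] [] [] [] [] l).toMachine φ⟩ := by
      intro l
      unfold Turing.haltList
      congr 1
      funext k
      rcases k with _ | w
      · rfl
      · cases w <;> rfl
    have hi' := (congrArg (fun l : List Bool => Turing.initList (c.machine φ) l)
      (List.map_id (ea a))).trans (hi _)
    have hf' := (congrArg (fun l : List B => Turing.haltList (c.machine φ) l)
      ((List.map_id (eb (g a))).trans (hout a).symm)).trans (hf _)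
    refine ⟨n + 1, by omega, ?_⟩
    exact hi' ▸ hf' ▸ IterStep.trans H (IterStep.one rfl)
  classical
  exact
    { steps := h'.choose
      evals_in_steps := h'.choose_spec.2
      steps_le_m := by simpa using h'.choose_spec.1 }

/-! ### Binary trees as data -/

/-- Binary trees: the data on which programs operate. -/
inductive Data
  | nil
  | node (a b : Data)

namespace Data

/-- The preorder code of a tree. -/
def code : Data → List Bool
  | nil => [false]
  | node a b => true :: (a.code ++ b.code)

/-- The length of the code of a tree. -/
def size (x : Data) : ℕ := x.code.length

@[simp] theorem size_nil : nil.size = 1 := rfl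

@[simp] theorem size_node (a b : Data) : (node a b).size = a.size + b.size + 1 := by
  simp [size, code]

theorem size_pos (x : Data) : 0 < x.size := by cases x <;> simp

end Data

open Data

/-- The stacks between two operations: only the main stack is used. -/
abbrev Stacks.idle (m i o : List Bool) : Stacks := ⟨m, [], [], [], [], [], i, o⟩

/-! ### Rearranging the topmost trees of the main stack. -/

namespace Cmd

/-- Move the content of a stack to another one, in reverse order. -/
def transfer (w w' : WorkStack) : Cmd := loop w (push w' false) (push w' true)

/-- Read a tree from the main stack and leave its reversed code on the stack `w`. -/
def take (w : WorkStack) : Cmd :=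
  push .count false ;; loop .count (pop .main skip (push w false)
    (push w true ;; push .count false ;; push .count false)) skip

/-- Exchange the two topmost trees. -/
def swap : Cmd := take .aux₁ ;; take .aux₂ ;; transfer .aux₁ .main ;; transfer .aux₂ .main

/-- Move the third topmost tree to the top. -/
def rotate : Cmd :=
  take .aux₁ ;; take .aux₂ ;; take .aux₃ ;; transfer .aux₂ .main ;; transfer .aux₁ .main ;;
    transfer .aux₃ .main

/-- Remove the topmost tree. -/
def drop : Cmd := take .aux₁ ;; loop .aux₁ skip skip

/-- Duplicate the topmost tree. -/
def dup : Cmd :=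
  take .aux₁ ;;
    loop .aux₁ (push .main false ;; push .aux₂ false) (push .main true ;; push .aux₂ true) ;;
    transfer .aux₂ .aux₁ ;; transfer .aux₁ .main

end Cmd

open Cmd

/-! ### Effect and running time of the stack operations. -/

theorem exec_pushMain (b : Bool) (m i o : List Bool) :
    Exec (push .main b) (.idle m i o) 1 (.idle (b :: m) i o) := Exec.push

theorem exec_popMain_true {c₀ c₁ c₂ : Cmd} {m i o : List Bool} {t : ℕ} {s : Stacks}
    (h : Exec c₂ (.idle m i o) t s) : Exec (pop .main c₀ c₁ c₂) (.idle (true :: m) i o) (t + 1) s :=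
  .popTrue rfl h

theorem exec_popMain_false {c₀ c₁ c₂ : Cmd} {m i o : List Bool} {t : ℕ} {s : Stacks}
    (h : Exec c₁ (.idle m i o) t s) :
    Exec (pop .main c₀ c₁ c₂) (.idle (false :: m) i o) (t + 1) s :=
  .popFalse rfl h

/-- `K` gives the state as a function of the two stacks involved. Its hypotheses hold by `rfl` for
each concrete pair of distinct stacks, so that one induction serves all of them. -/
theorem exec_transfer {w w' : WorkStack} (K : List Bool → List Bool → Stacks)
    (hw : ∀ l l', (K l l').get w = l) (hw' : ∀ l l', (K l l').get w' = l')
    (sw : ∀ l l' k, (K l l').set w k = K k l') (sw' : ∀ l l' k, (K l l').set w' k = K l k)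
    (l l' : List Bool) :
    Exec (transfer w w') (K l l') (2 * l.length + 1) (K [] (l.reverse ++ l')) := by
  induction l generalizing l' with
  | nil => exact .loopNil (hw _ _)
  | cons b l ih =>
    have hpush : Exec (push w' b) (K l l') 1 (K l (b :: l')) := by
      have := Exec.push (s := K l l') (w := w') (b := b)
      rwa [hw', sw'] at this
    have H := ih (b :: l')
    rw [List.reverse_cons, List.append_assoc]
    cases b with
    | false =>
      exact (Exec.loopFalse (hw _ _) (by rw [sw]; exact hpush) H).mono
        (by rw [List.length_cons]; omega)
    | true =>
      exact (Exec.loopTrue (hw _ _) (by rw [sw]; exact hpush) H).mono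
        (by rw [List.length_cons]; omega)

theorem exec_take {w : WorkStack} (K : List Bool → List Bool → List Bool → Stacks)
    (gm : ∀ m l k, (K m l k).get .main = m) (gw : ∀ m l k, (K m l k).get w = l)
    (gc : ∀ m l k, (K m l k).get .count = k) (sm : ∀ m l k r, (K m l k).set .main r = K r l k)
    (sw : ∀ m l k r, (K m l k).set w r = K m r k)
    (sc : ∀ m l k r, (K m l k).set .count r = K m l r) (x : Data) (m l : List Bool) :
    Exec (take w) (K (x.code ++ m) l []) (5 * x.size + 2) (K m (x.code.reverse ++ l) []) := by
  have pw : ∀ m l k b, Exec (push w b) (K m l k) 1 (K m (b :: l) k) := by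
    intro m l k b
    have := Exec.push (s := K m l k) (w := w) (b := b)
    rwa [gw, sw] at this
  have pc : ∀ m l k, Exec (push .count false) (K m l k) 1 (K m l (false :: k)) := by
    intro m l k
    have := Exec.push (s := K m l k) (w := .count) (b := false)
    rwa [gc, sc] at this
  -- Each symbol on the counter stands for one subtree still to be read: a leaf uses up one symbol,
  -- an inner node replaces one by two. The claim prolongs a given run backwards, so the runs for
  -- the two subtrees of a node can be chained.
  have key : ∀ (x : Data) (m l k : List Bool) (t : ℕ) (s : Stacks),
      Exec (loop .count (pop .main skip (push w false)
        (push w true ;; push .count false ;; push .count false)) skip)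
        (K m (x.code.reverse ++ l) k) t s →
      Exec (loop .count (pop .main skip (push w false)
        (push w true ;; push .count false ;; push .count false)) skip)
        (K (x.code ++ m) l (false :: k)) (t + 5 * x.size) s := by
    intro x
    induction x with
    | nil =>
      intro m l k t s h
      refine (Exec.loopFalse (gc _ _ _) ?_ h).mono (t := 2 + t + 1) (by simp; omega)
      rw [sc]
      refine Exec.popFalse (l := m) (gm _ _ _) ?_
      rw [sm]
      exact pw _ _ _ _
    | node a b iha ihb =>
      intro m l k t s h
      have h1 := ihb m ((true :: a.code).reverse ++ l) k t s (by
        simpa [code, List.append_assoc] using h)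
      have h2 := iha (b.code ++ m) (true :: l) (false :: k) _ s (by
        simpa [code, List.append_assoc] using h1)
      refine (Exec.loopFalse (gc _ _ _) ?_ h2).mono (t := 4 + (t + 5 * b.size + 5 * a.size) + 1)
        (by simp; omega)
      rw [sc]
      refine Exec.popTrue (l := a.code ++ (b.code ++ m)) (by rw [gm]; simp [code]) ?_
      rw [sm]
      exact (pw _ _ _ _).seq ((pc _ _ _).seq (pc _ _ _))
  refine ((pc _ _ _).seq (key x m l [] 1 _ (.loopNil (gc _ _ _)))).mono (by omega)

theorem exec_take₁ (x : Data) (m a b c f i o : List Bool) :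
    Exec (take .aux₁) ⟨x.code ++ m, a, b, c, [], f, i, o⟩ (5 * x.size + 2)
      ⟨m, x.code.reverse ++ a, b, c, [], f, i, o⟩ :=
  exec_take (fun m l k => ⟨m, l, b, c, k, f, i, o⟩) (fun _ _ _ => rfl) (fun _ _ _ => rfl)
    (fun _ _ _ => rfl) (fun _ _ _ _ => rfl) (fun _ _ _ _ => rfl) (fun _ _ _ _ => rfl) x m a

theorem exec_take₂ (x : Data) (m a b c f i o : List Bool) :
    Exec (take .aux₂) ⟨x.code ++ m, a, b, c, [], f, i, o⟩ (5 * x.size + 2)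
      ⟨m, a, x.code.reverse ++ b, c, [], f, i, o⟩ :=
  exec_take (fun m l k => ⟨m, a, l, c, k, f, i, o⟩) (fun _ _ _ => rfl) (fun _ _ _ => rfl)
    (fun _ _ _ => rfl) (fun _ _ _ _ => rfl) (fun _ _ _ _ => rfl) (fun _ _ _ _ => rfl) x m b

theorem exec_take₃ (x : Data) (m a b c f i o : List Bool) :
    Exec (take .aux₃) ⟨x.code ++ m, a, b, c, [], f, i, o⟩ (5 * x.size + 2)
      ⟨m, a, b, x.code.reverse ++ c, [], f, i, o⟩ :=
  exec_take (fun m l k => ⟨m, a, b, l, k, f, i, o⟩) (fun _ _ _ => rfl) (fun _ _ _ => rfl)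
    (fun _ _ _ => rfl) (fun _ _ _ _ => rfl) (fun _ _ _ _ => rfl) (fun _ _ _ _ => rfl) x m c

theorem exec_restore₁ (x : Data) (m b c k f i o : List Bool) :
    Exec (transfer .aux₁ .main) ⟨m, x.code.reverse, b, c, k, f, i, o⟩ (2 * x.size + 1)
      ⟨x.code ++ m, [], b, c, k, f, i, o⟩ := by
  have := exec_transfer (w := .aux₁) (w' := .main) (fun l l' => ⟨l', l, b, c, k, f, i, o⟩)
    (fun _ _ => rfl) (fun _ _ => rfl) (fun _ _ _ => rfl) (fun _ _ _ => rfl) x.code.reverse m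
  rwa [List.reverse_reverse, List.length_reverse] at this

theorem exec_restore₂ (x : Data) (m a c k f i o : List Bool) :
    Exec (transfer .aux₂ .main) ⟨m, a, x.code.reverse, c, k, f, i, o⟩ (2 * x.size + 1)
      ⟨x.code ++ m, a, [], c, k, f, i, o⟩ := by
  have := exec_transfer (w := .aux₂) (w' := .main) (fun l l' => ⟨l', a, l, c, k, f, i, o⟩)
    (fun _ _ => rfl) (fun _ _ => rfl) (fun _ _ _ => rfl) (fun _ _ _ => rfl) x.code.reverse m
  rwa [List.reverse_reverse, List.length_reverse] at this

theorem exec_restore₃ (x : Data) (m a b k f i o : List Bool) :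
    Exec (transfer .aux₃ .main) ⟨m, a, b, x.code.reverse, k, f, i, o⟩ (2 * x.size + 1)
      ⟨x.code ++ m, a, b, [], k, f, i, o⟩ := by
  have := exec_transfer (w := .aux₃) (w' := .main) (fun l l' => ⟨l', a, b, l, k, f, i, o⟩)
    (fun _ _ => rfl) (fun _ _ => rfl) (fun _ _ _ => rfl) (fun _ _ _ => rfl) x.code.reverse m
  rwa [List.reverse_reverse, List.length_reverse] at this

/-- `take` stores a code in reverse and `transfer` reverses it again; the order in which the trees
are restored determines the permutation. The same applies to `exec_rotate`. -/
theorem exec_swap (x y : Data) (m f i o : List Bool) :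
    Exec swap ⟨x.code ++ (y.code ++ m), [], [], [], [], f, i, o⟩ (7 * (x.size + y.size) + 6)
      ⟨y.code ++ (x.code ++ m), [], [], [], [], f, i, o⟩ := by
  have h1 := exec_take₁ x (y.code ++ m) [] [] [] f i o
  have h2 := exec_take₂ y m (x.code.reverse ++ []) [] [] f i o
  rw [List.append_nil] at h1 h2
  rw [List.append_nil] at h2
  exact (h1.seq (h2.seq ((exec_restore₁ x m _ [] [] f i o).seq
    (exec_restore₂ y (x.code ++ m) [] [] [] f i o)))).mono (by omega)

theorem exec_rotate (x y z : Data) (m f i o : List Bool) :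
    Exec rotate ⟨x.code ++ (y.code ++ (z.code ++ m)), [], [], [], [], f, i, o⟩
      (7 * (x.size + y.size + z.size) + 9)
      ⟨z.code ++ (x.code ++ (y.code ++ m)), [], [], [], [], f, i, o⟩ := by
  have h1 := exec_take₁ x (y.code ++ (z.code ++ m)) [] [] [] f i o
  have h2 := exec_take₂ y (z.code ++ m) x.code.reverse [] [] f i o
  have h3 := exec_take₃ z m x.code.reverse y.code.reverse [] f i o
  rw [List.append_nil] at h1 h2 h3
  exact (h1.seq (h2.seq (h3.seq ((exec_restore₂ y m _ _ [] f i o).seq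
    ((exec_restore₁ x (y.code ++ m) _ _ [] f i o).seq
      (exec_restore₃ z _ [] [] [] f i o)))))).mono (by omega)

theorem exec_clear (l m b c k f i o : List Bool) :
    Exec (loop .aux₁ skip skip) ⟨m, l, b, c, k, f, i, o⟩ (l.length + 1)
      ⟨m, [], b, c, k, f, i, o⟩ := by
  induction l with
  | nil => exact .loopNil rfl
  | cons x l ih =>
    cases x with
    | false => exact (Exec.loopFalse rfl .skip ih).mono (by simp)
    | true => exact (Exec.loopTrue rfl .skip ih).mono (by simp)

theorem exec_drop (x : Data) (m i o : List Bool) :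
    Exec drop (.idle (x.code ++ m) i o) (6 * x.size + 3) (.idle m i o) := by
  have h1 := exec_take₁ x m [] [] [] [] i o
  refine (h1.seq (exec_clear _ m [] [] [] [] i o)).mono ?_
  simp only [List.append_nil, List.length_reverse]
  change 5 * x.size + 2 + (x.size + 1) ≤ _
  omega

theorem exec_fork (l m b i o : List Bool) :
    Exec (loop .aux₁ (push .main false ;; push .aux₂ false) (push .main true ;; push .aux₂ true))
      ⟨m, l, b, [], [], [], i, o⟩ (3 * l.length + 1)
      ⟨l.reverse ++ m, [], l.reverse ++ b, [], [], [], i, o⟩ := by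
  induction l generalizing m b with
  | nil => exact .loopNil rfl
  | cons x l ih =>
    have H := ih (x :: m) (x :: b)
    rw [List.reverse_cons, List.append_assoc, List.append_assoc]
    cases x with
    | false =>
      exact (Exec.loopFalse rfl (Exec.push.seq Exec.push) H).mono
        (by rw [List.length_cons]; omega)
    | true =>
      exact (Exec.loopTrue rfl (Exec.push.seq Exec.push) H).mono
        (by rw [List.length_cons]; omega)

theorem exec_dup (x : Data) (m i o : List Bool) :
    Exec dup (.idle (x.code ++ m) i o) (12 * x.size + 5)
      (.idle (x.code ++ (x.code ++ m)) i o) := by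
  have h1 := exec_take₁ x m [] [] [] [] i o
  rw [List.append_nil] at h1
  have h2 := exec_fork x.code.reverse m [] i o
  rw [List.reverse_reverse, List.append_nil, List.length_reverse] at h2
  have h3 := exec_transfer (w := .aux₂) (w' := .aux₁)
    (fun l l' => ⟨x.code ++ m, l', l, [], [], [], i, o⟩)
    (fun _ _ => rfl) (fun _ _ => rfl) (fun _ _ _ => rfl) (fun _ _ _ => rfl) x.code []
  rw [List.append_nil] at h3
  have h4 := exec_restore₁ x (x.code ++ m) [] [] [] [] i o
  refine (h1.seq (h2.seq (h3.seq h4))).mono ?_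
  change 5 * x.size + 2 + (3 * x.size + 1 + (2 * x.size + 1 + (2 * x.size + 1))) ≤ _
  omega

/-! ### Functions computed by polynomial-time programs -/

/-- Types whose elements are represented by trees. -/
class TreeRep (α : Type) where
  /-- The tree that represents an element. -/
  toData : α → Data


instance : TreeRep Bool where
  toData b := cond b (.node .nil .nil) .nil

instance {α β : Type} [TreeRep α] [TreeRep β] : TreeRep (α × β) where
  toData x := .node (TreeRep.toData x.1) (TreeRep.toData x.2)

/-- The tree of a list of trees. -/
def listData {α : Type} [TreeRep α] : List α → Data
  | [] => .nil
  | a :: l => .node (TreeRep.toData a) (listData l)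

instance {α : Type} [TreeRep α] : TreeRep (List α) := ⟨listData⟩

/-- The size of the representation of an element. -/
def rsize {α : Type} [TreeRep α] (a : α) : ℕ := (TreeRep.toData a).size

/-- The code of the representation of an element. -/
def rcode {α : Type} [TreeRep α] (a : α) : List Bool := (TreeRep.toData a).code

section

variable {α β γ δ : Type} [TreeRep α] [TreeRep β] [TreeRep γ] [TreeRep δ]

@[simp] theorem rsize_pair (a : α) (b : β) : rsize (a, b) = rsize a + rsize b + 1 :=
  size_node _ _

@[simp] theorem rsize_nil : rsize ([] : List α) = 1 := rfl

@[simp] theorem rsize_cons (a : α) (l : List α) : rsize (a :: l) = rsize a + rsize l + 1 :=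
  size_node _ _

theorem rsize_pos (a : α) : 0 < rsize a := size_pos _

theorem rcode_pair (a : α) (b : β) : rcode (a, b) = true :: (rcode a ++ rcode b) := rfl

theorem rcode_cons (a : α) (l : List α) : rcode (a :: l) = true :: (rcode a ++ rcode l) := rfl

theorem length_le_rsize (l : List α) : l.length ≤ rsize l := by
  induction l with
  | nil => simp
  | cons a l ih => simp; omega

theorem rsize_append (l l' : List α) : rsize (l ++ l') + 1 = rsize l + rsize l' := by
  induction l with
  | nil => simp; omega
  | cons a l ih => simp; omega

theorem rsize_mem_le {a : α} {l : List α} (h : a ∈ l) : rsize a ≤ rsize l := by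
  induction l with
  | nil => simp at h
  | cons b l ih =>
    rcases List.mem_cons.1 h with rfl | h
    · simp; omega
    · have := ih h; simp; omega

/-- Coefficients are natural numbers, so a bound on the argument may be inserted into a time bound.
-/
theorem Polynomial.eval_mono_nat (p : Polynomial ℕ) {a b : ℕ} (h : a ≤ b) :
    p.eval a ≤ p.eval b := by
  rw [Polynomial.eval_eq_sum_range, Polynomial.eval_eq_sum_range]
  exact Finset.sum_le_sum fun i _ => Nat.mul_le_mul_left _ (Nat.pow_le_pow_left h i)

/-- `f` is computed by a program in polynomial time. -/
def Feasible (f : α → β) : Prop :=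
  ∃ (c : Cmd) (p : Polynomial ℕ), ∀ a m i o, Exec c (.idle (rcode a ++ m) i o) (p.eval (rsize a))
    (.idle (rcode (f a) ++ m) i o)

/-! ### Closure properties of feasible functions. -/

namespace Feasible

/-- A stack gains at most one symbol per step, so a time bound also bounds the size of the result.
Time bounds can be composed for this reason. -/
theorem rsize_le {f : α → β} (hf : Feasible f) :
    ∃ q : Polynomial ℕ, ∀ a, rsize (f a) ≤ q.eval (rsize a) := by
  obtain ⟨c, p, h⟩ := hf
  refine ⟨.X + p, fun a => ?_⟩
  have := (h a [] [] []).length_main_le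
  simpa [rsize, size, rcode] using this

theorem id : Feasible fun a : α => a :=
  ⟨.skip, 0, fun _ _ _ _ => Exec.skip.mono (Nat.zero_le _)⟩

theorem comp {g : β → γ} {f : α → β} (hg : Feasible g) (hf : Feasible f) :
    Feasible fun a => g (f a) := by
  obtain ⟨q, hq⟩ := hf.rsize_le
  obtain ⟨c, p, h⟩ := hf
  obtain ⟨c', p', h'⟩ := hg
  refine ⟨c ;; c', p + p'.comp q, fun a m i o => ((h a m i o).seq (h' (f a) m i o)).mono ?_⟩
  rw [Polynomial.eval_add, Polynomial.eval_comp]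
  exact Nat.add_le_add_left (p'.eval_mono_nat (hq a)) _

/-- The argument is duplicated, `g` is evaluated on the upper copy, and after an exchange `f` on the
other one. A final node symbol joins the two adjacent codes to the code of a pair. -/
theorem pair {f : α → β} {g : α → γ} (hf : Feasible f) (hg : Feasible g) :
    Feasible fun a => (f a, g a) := by
  obtain ⟨q, hq⟩ := hg.rsize_le
  obtain ⟨c, p, h⟩ := hf
  obtain ⟨c', p', h'⟩ := hg
  refine ⟨dup ;; c' ;; swap ;; c ;; push .main true, 19 * .X + 12 + p + p' + 7 * q,
    fun a m i o => ?_⟩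
  change Exec _ _ _ (.idle (true :: (rcode (f a) ++ rcode (g a)) ++ m) i o)
  rw [List.cons_append, List.append_assoc]
  refine ((exec_dup _ _ i o).seq ((h' a _ i o).seq ((exec_swap _ _ _ _ i o).seq
    ((h a _ i o).seq (exec_pushMain _ _ _ _))))).mono ?_
  have := hq a
  simp only [Polynomial.eval_add, Polynomial.eval_mul, Polynomial.eval_ofNat, Polynomial.eval_X]
  change 12 * rsize a + 5 + (p'.eval (rsize a) + ((7 * (rsize (g a) + rsize a) + 6) +
    (p.eval (rsize a) + 1))) ≤ _
  omega

/-- Data are computed by pushing their code. -/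
theorem exec_const (x : Data) : ∃ c t, ∀ m i o, Exec c (.idle m i o) t (.idle (x.code ++ m) i o) := by
  induction x with
  | nil => exact ⟨push .main false, 1, fun _ _ _ => Exec.push⟩
  | node a b iha ihb =>
    obtain ⟨c, t, h⟩ := iha
    obtain ⟨c', t', h'⟩ := ihb
    refine ⟨c' ;; c ;; push .main true, t' + (t + 1), fun m i o => ?_⟩
    have := (h' m i o).seq ((h _ i o).seq (Exec.push (w := .main) (b := true)))
    rw [← List.append_assoc] at this
    exact this

theorem const (b : β) : Feasible fun _ : α => b := by
  obtain ⟨c, t, h⟩ := exec_const (TreeRep.toData b)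
  refine ⟨drop ;; c, 6 * .X + 3 + .C t, fun a m i o => ?_⟩
  refine ((exec_drop _ _ _ _).seq (h m i o)).mono ?_
  simp [rsize]

theorem fst {f : α → β × γ} (hf : Feasible f) : Feasible fun a => (f a).1 := by
  refine comp (g := Prod.fst) ?_ hf
  refine ⟨pop .main skip skip (swap ;; drop), 13 * .X + 10, fun a m i o => ?_⟩
  obtain ⟨b, c⟩ := a
  rw [rcode_pair, List.cons_append, List.append_assoc]
  refine (Exec.popTrue rfl ((exec_swap _ _ m _ i o).seq (exec_drop _ _ i o))).mono ?_
  simp only [Polynomial.eval_add, Polynomial.eval_mul, Polynomial.eval_ofNat, Polynomial.eval_X,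
    rsize_pair]
  change (7 * (rsize b + rsize c) + 6) + (6 * rsize c + 3) + 1 ≤ _
  omega

theorem snd {f : α → β × γ} (hf : Feasible f) : Feasible fun a => (f a).2 := by
  refine comp (g := Prod.snd) ?_ hf
  refine ⟨pop .main skip skip drop, 6 * .X + 4, fun a m i o => ?_⟩
  obtain ⟨b, c⟩ := a
  rw [rcode_pair, List.cons_append, List.append_assoc]
  refine (Exec.popTrue rfl (exec_drop _ _ i o)).mono ?_
  simp only [Polynomial.eval_add, Polynomial.eval_mul, Polynomial.eval_ofNat, Polynomial.eval_X,
    rsize_pair]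
  change 6 * rsize b + 3 + 1 ≤ _
  omega

theorem cond {b : α → Bool} {f g : α → β} (hb : Feasible b) (hf : Feasible f) (hg : Feasible g) :
    Feasible fun a => bif b a then f a else g a := by
  refine comp (g := fun x : Bool × α => bif x.1 then f x.2 else g x.2) ?_ (pair hb id)
  obtain ⟨c, p, h⟩ := hf
  obtain ⟨c', p', h'⟩ := hg
  -- The first pop removes the node of the pair. The code of `false` is a single leaf symbol; the
  -- code of `true` has a node and two leaves, which explains the two further pops before `c`.
  refine ⟨pop .main skip skip (pop .main skip c' (pop .main skip (pop .main skip c c) skip)),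
    4 + p + p', fun a m i o => ?_⟩
  obtain ⟨b, a⟩ := a
  have hmono : ∀ r : Polynomial ℕ, r.eval (rsize a) ≤ r.eval (rsize (b, a)) := fun r =>
    r.eval_mono_nat (by simp; omega)
  have h1 := hmono p
  have h2 := hmono p'
  simp only [Polynomial.eval_add, Polynomial.eval_ofNat]
  cases b with
  | false =>
    exact (exec_popMain_true (exec_popMain_false (h' a m i o))).mono (by omega)
  | true =>
    exact (exec_popMain_true (exec_popMain_true
      (exec_popMain_false (exec_popMain_false (h a m i o))))).mono (by omega)

theorem nil : Feasible fun _ : α => ([] : List β) := const _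

theorem cons {f : α → β} {g : α → List β} (hf : Feasible f) (hg : Feasible g) :
    Feasible fun a => f a :: g a := pair hf hg

theorem listCases {l : α → List β} {f : α → γ} {g : α × β × List β → γ} (hl : Feasible l)
    (hf : Feasible f) (hg : Feasible g) :
    Feasible fun a => match l a with
      | [] => f a
      | b :: l' => g (a, b, l') := by
  refine comp (g := fun x : List β × α => match x.1 with
    | [] => f x.2
    | b :: l' => g (x.2, b, l')) ?_ (pair hl id)
  obtain ⟨c, p, h⟩ := hf
  obtain ⟨c', p', h'⟩ := hg
  -- In the nonempty case the root symbol of the list is pushed back, so that the list can be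
  -- exchanged with `a` as one tree. Since a cons cell and a pair have the same code, the result is
  -- the code of `(a, b, l)`.
  refine ⟨pop .main skip skip (pop .main skip c
      (push .main true ;; swap ;; push .main true ;; c')), 7 * .X + 10 + p + p',
    fun x m i o => ?_⟩
  obtain ⟨l, a⟩ := x
  have h1 : p.eval (rsize a) ≤ p.eval (rsize (l, a)) := p.eval_mono_nat (by simp; omega)
  simp only [Polynomial.eval_add, Polynomial.eval_mul, Polynomial.eval_ofNat, Polynomial.eval_X]
  cases l with
  | nil =>
    exact (exec_popMain_true (exec_popMain_false (h a m i o))).mono (by omega)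
  | cons b l =>
    have h2 : p'.eval (rsize (a, b, l)) ≤ p'.eval (rsize (b :: l, a)) :=
      p'.eval_mono_nat (by simp; omega)
    have h3 := exec_swap (TreeRep.toData (b :: l)) (TreeRep.toData a) m [] i o
    have hs : rsize (b :: l, a) = (TreeRep.toData (b :: l)).size + (TreeRep.toData a).size + 1 :=
      rsize_pair _ _
    have h5 := h' (a, b, l) m i o
    rw [rcode_pair, rcode_pair, List.cons_append, List.append_assoc] at h5
    rw [rcode_pair, List.cons_append, List.append_assoc]
    have h4 := exec_popMain_true (c₀ := skip) (c₁ := skip) (exec_popMain_true (c₀ := skip) (c₁ := c)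
      ((exec_pushMain _ _ _ _).seq (h3.seq ((exec_pushMain _ _ _ _).seq h5))))
    exact h4.mono (by omega)

end Feasible

end

open Cmd Data

/-! ### Recursion over lists -/

namespace Feasible

section

variable {α β γ δ : Type} [TreeRep α] [TreeRep β] [TreeRep γ] [TreeRep δ]

/-- The remaining list lies above the state. The loop runs on the flag stack, which is refilled
after each list element and left empty at the end of the list. The bounds `S` and `N` on state and
list give a uniform cost per round. -/
theorem exec_foldLoop {f : β × α → β} {c : Cmd} {p : Polynomial ℕ} {m i o : List Bool}
    (h : ∀ x m i o, Exec c (.idle (rcode x ++ m) i o) (p.eval (rsize x))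
      (.idle (rcode (f x) ++ m) i o)) (S N : ℕ) (l : List α) (s : β)
    (hS : ∀ l₁ l₂, l = l₁ ++ l₂ → rsize (l₁.foldl (fun s a => f (s, a)) s) ≤ S)
    (hN : rsize l ≤ N) :
    Exec (loop .flag (pop .main skip skip
        (rotate ;; push .main true ;; c ;; swap ;; push .flag false)) skip)
      ⟨rcode l ++ (rcode s ++ m), [], [], [], [], [false], i, o⟩
      (l.length * (p.eval (1 + S + N) + 14 * (S + N) + 20) + 3)
      (.idle (rcode (l.foldl (fun s a => f (s, a)) s) ++ m) i o) := by
  induction l generalizing s with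
  | nil =>
    exact (Exec.loopFalse rfl (exec_popMain_false Exec.skip) (.loopNil rfl)).mono (by simp)
  | cons a l ih =>
    have hs : rsize s ≤ S := hS [] _ rfl
    have hs' : rsize (f (s, a)) ≤ S := hS [a] l rfl
    have hN' : rsize a + rsize l + 1 ≤ N := by simpa using hN
    have h1 := exec_rotate (TreeRep.toData a) (TreeRep.toData l) (TreeRep.toData s) m [] i o
    have h2 := h (s, a) (rcode l ++ m) i o
    rw [rcode_pair, List.cons_append, List.append_assoc] at h2
    have h3 := exec_swap (TreeRep.toData (f (s, a))) (TreeRep.toData l) m [] i o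
    have H := ih (f (s, a)) (fun l₁ l₂ e => hS (a :: l₁) l₂ (by rw [e]; rfl)) (by omega)
    rw [rcode_cons, List.cons_append, List.append_assoc]
    refine (Exec.loopFalse rfl (exec_popMain_true (h1.seq ((exec_pushMain _ _ _ _).seq
      (h2.seq (h3.seq Exec.push))))) H).mono ?_
    have hp : p.eval (rsize (s, a)) ≤ p.eval (1 + S + N) := p.eval_mono_nat (by simp; omega)
    change (7 * (rsize a + rsize l + rsize s) + 9 + (1 + (_ + (7 * (rsize (f (s, a)) + rsize l) +
      6 + 1))) + 1) + _ + 1 ≤ _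
    rw [List.length_cons, Nat.add_one_mul l.length]
    omega

/-- Iterating a feasible step may square the size each time, so a polynomial bound on the states has
to be supplied. It is needed only for the states that occur, those after prefixes of the given list.
-/
theorem foldl_state {l : γ → List α} {s : γ → β} {f : β × α → β} (hl : Feasible l)
    (hs : Feasible s) (hf : Feasible f) (P : Polynomial ℕ)
    (hP : ∀ x l₁ l₂, l x = l₁ ++ l₂ →
      rsize (l₁.foldl (fun s a => f (s, a)) (s x)) ≤ P.eval (rsize x)) :
    Feasible fun x => (l x).foldl (fun s a => f (s, a)) (s x) := by
  obtain ⟨q, hq⟩ := hl.rsize_le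
  obtain ⟨c, p, h⟩ := pair hs hl
  obtain ⟨c', p', h'⟩ := hf
  refine ⟨c ;; pop .main skip skip (swap ;; push .flag false ;; loop .flag (pop .main skip skip
      (rotate ;; push .main true ;; c' ;; swap ;; push .flag false)) skip),
    p + 7 * (P + q) + 11 + q * (p'.comp (1 + P + q) + 14 * (P + q) + 20), fun x m i o => ?_⟩
  have h1 := h x m i o
  rw [rcode_pair, List.cons_append, List.append_assoc] at h1
  have h2 := exec_swap (TreeRep.toData (s x)) (TreeRep.toData (l x)) m [] i o
  have h3 := exec_foldLoop (m := m) (i := i) (o := o) h' (P.eval (rsize x)) (q.eval (rsize x))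
    (l x) (s x) (hP x) (hq x)
  refine (h1.seq (exec_popMain_true (h2.seq (Exec.push.seq h3)))).mono ?_
  have hs0 : rsize (s x) ≤ P.eval (rsize x) := hP x [] _ rfl
  have hl0 := hq x
  have hlen : (l x).length ≤ q.eval (rsize x) := (length_le_rsize _).trans hl0
  have := Nat.mul_le_mul_right
    (p'.eval (1 + P.eval (rsize x) + q.eval (rsize x)) +
      14 * (P.eval (rsize x) + q.eval (rsize x)) + 20) hlen
  simp only [Polynomial.eval_add, Polynomial.eval_mul, Polynomial.eval_ofNat, Polynomial.eval_one,
    Polynomial.eval_comp]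
  change _ + ((7 * (rsize (s x) + rsize (l x)) + 6) + _ + 1) ≤ _
  omega

/-- Left folds whose intermediate states have polynomial size. -/
theorem foldl {l : γ → List α} {s : γ → β} {f : γ → β → α → β} (hl : Feasible l)
    (hs : Feasible s) (hf : Feasible fun x : γ × β × α => f x.1 x.2.1 x.2.2)
    (hP : ∃ P : Polynomial ℕ, ∀ x l₁ l₂, l x = l₁ ++ l₂ →
      rsize (l₁.foldl (f x) (s x)) ≤ P.eval (rsize x)) :
    Feasible fun x => (l x).foldl (f x) (s x) := by
  obtain ⟨P, hP⟩ := hP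
  -- The parameter `x` is carried along as part of the state, which makes the step function
  -- independent of it.
  have key : ∀ x (l : List α) s,
      l.foldl (fun (s : γ × β) a => ((fun y : (γ × β) × α => (y.1.1, f y.1.1 y.1.2 y.2)) (s, a)))
        (x, s) = (x, l.foldl (f x) s) := by
    intro x l
    induction l with
    | nil => exact fun _ => rfl
    | cons a l ih => exact fun s => ih _
  have hstep : Feasible (fun y : (γ × β) × α => (y.1.1, f y.1.1 y.1.2 y.2)) :=
    pair (fst (fst id)) (hf.comp (pair (fst (fst id)) (pair (snd (fst id)) (snd id))))
  have := foldl_state hl (pair id hs) hstep (.X + P + 1) (fun x l₁ l₂ e => by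
    rw [key]
    have := hP x l₁ l₂ e
    simp only [rsize_pair, Polynomial.eval_add, Polynomial.eval_X, Polynomial.eval_one]
    omega)
  simpa only [key] using snd this

/-- Left folds whose states grow by a polynomial amount in each step. -/
theorem foldl_of_growth {l : γ → List α} {s : γ → β} {f : γ → β → α → β} (hl : Feasible l)
    (hs : Feasible s) (hf : Feasible fun x : γ × β × α => f x.1 x.2.1 x.2.2)
    (hP : ∃ P : Polynomial ℕ, ∀ x s, ∀ a ∈ l x, rsize (f x s a) ≤ rsize s + P.eval (rsize x)) :
    Feasible fun x => (l x).foldl (f x) (s x) := by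
  obtain ⟨P, hP⟩ := hP
  obtain ⟨q, hq⟩ := hl.rsize_le
  obtain ⟨r, hr⟩ := hs.rsize_le
  refine foldl hl hs hf ⟨r + q * P, fun x l₁ l₂ e => ?_⟩
  have key : ∀ (l' : List α) s, (∀ a ∈ l', a ∈ l x) →
      rsize (l'.foldl (f x) s) ≤ rsize s + l'.length * P.eval (rsize x) := by
    intro l'
    induction l' with
    | nil => simp
    | cons a l' ih =>
      intro s h
      have h1 := ih (f x s a) fun b hb => h b (List.mem_cons_of_mem _ hb)
      have h2 := hP x s a (h a List.mem_cons_self)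
      rw [List.foldl_cons, List.length_cons, Nat.succ_mul]
      omega
  have h1 := key l₁ (s x) fun a ha => by rw [e]; exact List.mem_append_left _ ha
  have h2 : l₁.length ≤ q.eval (rsize x) := by
    have h3 := (length_le_rsize (l x)).trans (hq x)
    have h4 : l₁.length ≤ (l x).length := by rw [e]; simp
    omega
  have h3 := Nat.mul_le_mul_right (P.eval (rsize x)) h2
  have h4 := hr x
  rw [Polynomial.eval_add, Polynomial.eval_mul]
  omega

/-- Programs see only the representing trees. This allows a change of the result type at no cost,
for instance between a number and the list of its binary digits. -/
theorem congr_rep {f : α → β} {g : α → γ} (hf : Feasible f)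
    (h : ∀ a, TreeRep.toData (f a) = TreeRep.toData (g a)) : Feasible g := by
  obtain ⟨c, p, hc⟩ := hf
  refine ⟨c, p, fun a m i o => ?_⟩
  have := hc a m i o
  rwa [rcode, rcode, h a] at this

theorem of_eq {f g : α → β} (hf : Feasible f) (h : ∀ a, f a = g a) : Feasible g :=
  hf.congr_rep fun a => by rw [h a]

theorem ite {p : α → Prop} [DecidablePred p] {f g : α → β} (hp : Feasible fun a => decide (p a))
    (hf : Feasible f) (hg : Feasible g) : Feasible fun a => if p a then f a else g a :=
  (cond hp hf hg).of_eq fun a => by by_cases h : p a <;> simp [h]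

theorem not {b : α → Bool} (hb : Feasible b) : Feasible fun a => !b a :=
  (cond hb (const false) (const true)).of_eq fun a => by cases b a <;> rfl

theorem and {b b' : α → Bool} (hb : Feasible b) (hb' : Feasible b') :
    Feasible fun a => b a && b' a :=
  (cond hb hb' (const false)).of_eq fun a => by cases b a <;> rfl

theorem or {b b' : α → Bool} (hb : Feasible b) (hb' : Feasible b') :
    Feasible fun a => b a || b' a :=
  (cond hb (const true) hb').of_eq fun a => by cases b a <;> rfl

theorem xor {b b' : α → Bool} (hb : Feasible b) (hb' : Feasible b') :
    Feasible fun a => (b a ^^ b' a) :=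
  (cond hb (not hb') hb').of_eq fun a => by cases b a <;> cases b' a <;> rfl

end

/-! ### List operations. -/

section

variable {α β γ δ : Type} [TreeRep α] [TreeRep β] [TreeRep γ] [TreeRep δ]

theorem revAppend {l l' : γ → List α} (hl : Feasible l) (hl' : Feasible l') :
    Feasible fun x => (l x).reverse ++ l' x := by
  obtain ⟨q, hq⟩ := hl.rsize_le
  have := foldl_of_growth (f := fun _ s a => a :: s) hl hl'
    (cons (snd (snd id)) (fst (snd id))) ⟨q + 1, fun x s a ha => by
      have h1 := (rsize_mem_le ha).trans (hq x)
      rw [rsize_cons, Polynomial.eval_add, Polynomial.eval_one]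
      omega⟩
  refine this.of_eq fun x => ?_
  generalize l x = l
  generalize l' x = l'
  induction l generalizing l' with
  | nil => rfl
  | cons a l ih => simp [ih]

theorem reverse {l : γ → List α} (hl : Feasible l) : Feasible fun x => (l x).reverse :=
  (revAppend hl nil).of_eq fun x => by simp

theorem append {l l' : γ → List α} (hl : Feasible l) (hl' : Feasible l') :
    Feasible fun x => l x ++ l' x :=
  (revAppend (reverse hl) hl').of_eq fun x => by simp

/-- Elements are no larger than their list, so the values of `g` are bounded uniformly. This bounds
the growth per step when the values are collected by a fold. -/
theorem rsize_le_of_mem {l : γ → List α} {g : γ → α → β} (hl : Feasible l)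
    (hg : Feasible fun x : γ × α => g x.1 x.2) :
    ∃ q : Polynomial ℕ, ∀ x, ∀ a ∈ l x, rsize (g x a) ≤ q.eval (rsize x) := by
  obtain ⟨q, hq⟩ := hl.rsize_le
  obtain ⟨r, hr⟩ := hg.rsize_le
  refine ⟨r.comp (.X + q + 1), fun x a ha => (hr (x, a)).trans ?_⟩
  rw [Polynomial.eval_comp]
  apply r.eval_mono_nat
  have := (rsize_mem_le ha).trans (hq x)
  simp only [rsize_pair, Polynomial.eval_add, Polynomial.eval_X, Polynomial.eval_one]
  omega

theorem map {l : γ → List α} {g : γ → α → β} (hl : Feasible l)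
    (hg : Feasible fun x : γ × α => g x.1 x.2) : Feasible fun x => (l x).map (g x) := by
  obtain ⟨q, hq⟩ := rsize_le_of_mem hl hg
  have := foldl_of_growth (f := fun x s a => g x a :: s) (s := fun _ => []) hl nil
    (cons (hg.comp (pair (fst id) (snd (snd id)))) (fst (snd id))) ⟨q + 1, fun x s a ha => by
      have h1 := hq x a ha
      rw [rsize_cons, Polynomial.eval_add, Polynomial.eval_one]
      omega⟩
  refine (reverse this).of_eq fun x => ?_
  have key : ∀ (l : List α) (s : List β),
      l.foldl (fun s a => g x a :: s) s = (l.map (g x)).reverse ++ s := by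
    intro l
    induction l with
    | nil => exact fun _ => rfl
    | cons a l ih => intro s; simp [ih]
  rw [key]
  simp

theorem flatMap {l : γ → List α} {g : γ → α → List β} (hl : Feasible l)
    (hg : Feasible fun x : γ × α => g x.1 x.2) : Feasible fun x => (l x).flatMap (g x) := by
  obtain ⟨q, hq⟩ := rsize_le_of_mem hl hg
  have := foldl_of_growth (f := fun x s a => s ++ g x a) (s := fun _ => []) hl nil
    (append (fst (snd id)) (hg.comp (pair (fst id) (snd (snd id))))) ⟨q, fun x s a ha => by
      have h1 := hq x a ha
      have h2 := rsize_append s (g x a)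
      omega⟩
  refine this.of_eq fun x => ?_
  have key : ∀ (l : List α) (s : List β),
      l.foldl (fun s a => s ++ g x a) s = s ++ l.flatMap (g x) := by
    intro l
    induction l with
    | nil => simp
    | cons a l ih => intro s; simp [ih]
  rw [key]
  rfl

theorem filter {l : γ → List α} {p : γ → α → Bool} (hl : Feasible l)
    (hp : Feasible fun x : γ × α => p x.1 x.2) : Feasible fun x => (l x).filter (p x) := by
  refine (flatMap (g := fun x a => bif p x a then [a] else []) hl
    (cond hp (cons (snd id) nil) nil)).of_eq fun x => ?_
  generalize l x = l
  induction l with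
  | nil => rfl
  | cons a l ih => cases h : p x a <;> simp [h, ih]

theorem rsize_bool_le (b : Bool) : rsize b ≤ 3 := by cases b <;> decide

theorem foldl_bool {l : γ → List α} {b : γ → Bool} {f : γ → Bool → α → Bool} (hl : Feasible l)
    (hb : Feasible b) (hf : Feasible fun x : γ × Bool × α => f x.1 x.2.1 x.2.2) :
    Feasible fun x => (l x).foldl (f x) (b x) :=
  foldl hl hb hf ⟨3, fun _ _ _ _ => by
    rw [Polynomial.eval_ofNat]
    exact rsize_bool_le _⟩

theorem all {l : γ → List α} {p : γ → α → Bool} (hl : Feasible l)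
    (hp : Feasible fun x : γ × α => p x.1 x.2) : Feasible fun x => (l x).all (p x) := by
  refine (foldl_bool (f := fun x s a => s && p x a) (b := fun _ => true) hl (const true)
    (and (fst (snd id)) (hp.comp (pair (fst id) (snd (snd id)))))).of_eq fun x => ?_
  have key : ∀ (l : List α) (s : Bool), l.foldl (fun s a => s && p x a) s = (s && l.all (p x)) := by
    intro l
    induction l with
    | nil => simp
    | cons a l ih => intro s; simp [ih, Bool.and_assoc]
  rw [key]
  rfl

theorem any {l : γ → List α} {p : γ → α → Bool} (hl : Feasible l)
    (hp : Feasible fun x : γ × α => p x.1 x.2) : Feasible fun x => (l x).any (p x) := by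
  refine (not (all (p := fun x a => !p x a) hl (not hp))).of_eq fun x => ?_
  simp [List.any_eq_not_all_not]

theorem tail {l : γ → List α} (hl : Feasible l) : Feasible fun x => (l x).tail :=
  (listCases (g := fun x : γ × α × List α => x.2.2) hl nil (snd (snd id))).of_eq fun x => by
    cases l x <;> rfl

theorem zip {l : γ → List α} {l' : γ → List β} (hl : Feasible l) (hl' : Feasible l') :
    Feasible fun x => (l x).zip (l' x) := by
  obtain ⟨q, hq⟩ := hl.rsize_le
  -- The state consists of the unread part of the second list and the reversed list of pairs found
  -- so far.
  let f : List β × List (α × β) → α → List β × List (α × β) := fun s a => match s.1 with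
    | [] => s
    | b :: r => (r, (a, b) :: s.2)
  have hf : Feasible fun x : γ × (List β × List (α × β)) × α => f x.2.1 x.2.2 :=
    listCases (l := fun x : γ × (List β × List (α × β)) × α => x.2.1.1)
      (f := fun x => x.2.1) (g := fun y => (y.2.2, (y.1.2.2, y.2.1) :: y.1.2.1.2))
      (fst (fst (snd id))) (fst (snd id))
      (pair (snd (snd id)) (cons (pair (snd (snd (fst id))) (fst (snd id)))
        (snd (fst (snd (fst id))))))
  have := foldl_of_growth (f := fun _ => f) hl (pair hl' nil) hf ⟨q + 2, fun x s a ha => by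
    have h1 := (rsize_mem_le ha).trans (hq x)
    rw [Polynomial.eval_add, Polynomial.eval_ofNat]
    obtain ⟨r, t⟩ := s
    cases r with
    | nil => change rsize (([] : List β), t) ≤ _; omega
    | cons b r => change rsize (r, (a, b) :: t) ≤ _; simp; omega⟩
  refine (reverse (snd this)).of_eq fun x => ?_
  have key : ∀ (l : List α) (r : List β) (t : List (α × β)),
      (l.foldl f (r, t)).2 = (l.zip r).reverse ++ t := by
    intro l
    induction l with
    | nil => simp
    | cons a l ih =>
      intro r t
      cases r with
      | nil =>
        have : ∀ l : List α, l.foldl f ([], t) = ([], t) := by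
          intro l
          induction l with
          | nil => rfl
          | cons a l ih => exact ih
        rw [this]
        simp
      | cons b r =>
        change (l.foldl f (r, (a, b) :: t)).2 = _
        rw [ih]
        simp
  rw [key]
  simp

theorem zipWith {l : γ → List α} {l' : γ → List β} {g : γ → α → β → δ} (hl : Feasible l)
    (hl' : Feasible l') (hg : Feasible fun x : γ × α × β => g x.1 x.2.1 x.2.2) :
    Feasible fun x => List.zipWith (g x) (l x) (l' x) :=
  (map (g := fun x (a : α × β) => g x a.1 a.2) (zip hl hl') hg).of_eq fun x => by
    rw [List.zip, List.map_zipWith]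

end

end Feasible

/-! ### Arithmetic of natural numbers in binary -/

instance : TreeRep ℕ := ⟨fun n => listData n.bits⟩

theorem rsize_nat_le (n : ℕ) : rsize n ≤ 4 * n.size + 1 := by
  have : ∀ l : List Bool, rsize l ≤ 4 * l.length + 1 := by
    intro l
    induction l with
    | nil => simp
    | cons b l ih => have := Feasible.rsize_bool_le b; simp; omega
  rw [← Nat.size_eq_bits_len]
  exact this _

theorem size_le_rsize (n : ℕ) : n.size ≤ rsize n := by
  rw [← Nat.size_eq_bits_len]
  exact length_le_rsize _

/-- The number with the given binary digits, the most significant digit first. -/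
def ofDigitsMSB (l : List Bool) : ℕ := l.foldl (fun n b => Nat.bit b n) 0

theorem ofDigitsMSB_append (l l' : List Bool) :
    ofDigitsMSB (l ++ l') = ofDigitsMSB l * 2 ^ l'.length + ofDigitsMSB l' := by
  have key : ∀ (l : List Bool) n,
      l.foldl (fun n b => Nat.bit b n) n = n * 2 ^ l.length + ofDigitsMSB l := by
    intro l
    induction l with
    | nil => simp [ofDigitsMSB]
    | cons b l ih =>
      intro n
      rw [ofDigitsMSB, List.foldl_cons, List.foldl_cons, ih, ih (Nat.bit b 0), List.length_cons,
        Nat.bit_val, Nat.bit_val]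
      ring
  rw [ofDigitsMSB, List.foldl_append, key]
  rfl

theorem ofDigitsMSB_reverse_bits (n : ℕ) : ofDigitsMSB n.bits.reverse = n := by
  induction n using Nat.binaryRec' with
  | zero => rfl
  | bit b n h ih =>
    rw [Nat.bits_append_bit _ _ h, List.reverse_cons, ofDigitsMSB_append, ih, Nat.bit_val]
    cases b <;> simp [ofDigitsMSB, mul_comm]

namespace Feasible

section

variable {γ : Type} [TreeRep γ]

theorem bits {a : γ → ℕ} (ha : Feasible a) : Feasible fun x => (a x).bits :=
  ha.congr_rep fun _ => rfl

theorem div2 {a : γ → ℕ} (ha : Feasible a) : Feasible fun x => (a x).div2 :=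
  (tail (bits ha)).congr_rep fun x => by
    change listData _ = listData _
    rw [Nat.div2_bits_eq_tail]

theorem bodd {a : γ → ℕ} (ha : Feasible a) : Feasible fun x => (a x).bodd :=
  (listCases (g := fun x : γ × Bool × List Bool => x.2.1) (bits ha) (const false)
    (fst (snd id))).of_eq fun x => by
      rw [Nat.bodd_eq_bits_head]
      cases (a x).bits <;> rfl

theorem eqZero {a : γ → ℕ} (ha : Feasible a) : Feasible fun x => decide (a x = 0) :=
  (listCases (g := fun _ : γ × Bool × List Bool => false) (bits ha) (const true)
    (const false)).of_eq fun x => by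
      have h : a x = 0 ↔ (a x).bits = [] := by
        rw [← List.length_eq_zero_iff, Nat.size_eq_bits_len, Nat.size_eq_zero]
      cases e : (a x).bits <;> simp [h, e]

theorem bit {b : γ → Bool} {a : γ → ℕ} (hb : Feasible b) (ha : Feasible a) :
    Feasible fun x => Nat.bit (b x) (a x) := by
  -- The number zero has no digits, so a zero digit must not be put in front of the empty list.
  refine (cond (and (not hb) (eqZero ha)) nil (cons hb (bits ha))).congr_rep fun x => ?_
  change listData _ = listData _
  congr 1
  by_cases h : a x = 0
  · rw [h]
    cases b x <;> simp
  · rw [Nat.bits_append_bit _ _ fun h' => absurd h' h]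
    simp [h]

theorem rsize_bit_le (b : Bool) (n : ℕ) : rsize (Nat.bit b n) ≤ rsize n + 4 := by
  have hb := rsize_bool_le b
  by_cases h : n = 0 → b = true
  · have : rsize (Nat.bit b n) = rsize (b :: n.bits) := by
      change (listData _).size = (listData _).size
      rw [Nat.bits_append_bit _ _ h]
    rw [this, rsize_cons]
    change _ + rsize n + 1 ≤ _
    omega
  · push Not at h
    obtain ⟨rfl, h⟩ := h
    cases b with
    | true => exact absurd rfl h
    | false => decide

theorem ofDigits {l : γ → List Bool} (hl : Feasible l) : Feasible fun x => ofDigitsMSB (l x) :=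
  foldl_of_growth (f := fun _ n b => Nat.bit b n) hl (const 0)
    (bit (snd (snd id)) (fst (snd id))) ⟨4, fun x s a _ => by
      rw [Polynomial.eval_ofNat]
      exact rsize_bit_le _ _⟩

/-- The state of binary addition: the carry, the remaining numbers and the digits found. -/
def addStep (s : Bool × ℕ × ℕ × List Bool) : Bool × ℕ × ℕ × List Bool :=
  ((s.1 && s.2.1.bodd) || ((s.1 && s.2.2.1.bodd) || (s.2.1.bodd && s.2.2.1.bodd)),
    s.2.1.div2, s.2.2.1.div2, (s.1 ^^ (s.2.1.bodd ^^ s.2.2.1.bodd)) :: s.2.2.2)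

/-- Invariant of written addition: the digits found, plus the matching power of two times the carry
and the unread parts of both numbers. New digits are put in front, so the most significant one comes
first. The folded list merely counts the steps. -/
theorem addStep_foldl {α : Type} (l : List α) (s : Bool × ℕ × ℕ × List Bool) :
    let t := l.foldl (fun s _ => addStep s) s
    t.2.2.2.length = s.2.2.2.length + l.length ∧
      ofDigitsMSB t.2.2.2 + 2 ^ t.2.2.2.length * (t.1.toNat + t.2.1 + t.2.2.1) =
        ofDigitsMSB s.2.2.2 + 2 ^ s.2.2.2.length * (s.1.toNat + s.2.1 + s.2.2.1) := by
  induction l generalizing s with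
  | nil => simp
  | cons x l ih =>
    obtain ⟨h1, h2⟩ := ih (addStep s)
    refine ⟨by rw [List.foldl_cons, h1]; simp [addStep]; omega, ?_⟩
    rw [List.foldl_cons, h2]
    obtain ⟨c, a, b, o⟩ := s
    have ha := Nat.bodd_add_div2 a
    have hb := Nat.bodd_add_div2 b
    have ho : ∀ d : Bool, ofDigitsMSB (d :: o) = d.toNat * 2 ^ o.length + ofDigitsMSB o := by
      intro d
      rw [← List.singleton_append, ofDigitsMSB_append]
      cases d <;> simp [ofDigitsMSB]
    simp only [addStep, ho, List.length_cons, pow_succ]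
    conv_rhs => rw [← ha, ← hb]
    cases c <;> cases a.bodd <;> cases b.bodd <;> simp <;> ring

theorem rsize_div2_le (n : ℕ) : rsize n.div2 ≤ rsize n := by
  change rsize n.div2.bits ≤ rsize n.bits
  rw [Nat.div2_bits_eq_tail]
  cases n.bits <;> simp
  omega

theorem add {a b : γ → ℕ} (ha : Feasible a) (hb : Feasible b) : Feasible fun x => a x + b x := by
  have hstep : Feasible addStep := by
    have h1 : Feasible fun s : Bool × ℕ × ℕ × List Bool => s.2.1.bodd := bodd (fst (snd id))
    have h2 : Feasible fun s : Bool × ℕ × ℕ × List Bool => s.2.2.1.bodd :=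
      bodd (fst (snd (snd id)))
    exact pair (or (and (fst id) h1) (or (and (fst id) h2) (and h1 h2)))
      (pair (div2 (fst (snd id))) (pair (div2 (fst (snd (snd id))))
        (cons (xor (fst id) (xor h1 h2)) (snd (snd (snd id))))))
  -- The number of steps exceeds the sum of the two binary lengths by one.
  have := foldl_of_growth (l := fun x => true :: ((a x).bits ++ (b x).bits))
    (s := fun x => (false, a x, b x, [])) (f := fun _ s _ => addStep s)
    (cons (const true) (append (bits ha) (bits hb))) (pair (const false) (pair ha (pair hb nil)))
    (hstep.comp (fst (snd id))) ⟨7, fun x s _ _ => by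
      have h1 := rsize_div2_le s.2.1
      have h2 := rsize_div2_le s.2.2.1
      have h3 := rsize_pos s.1
      have h4 := rsize_bool_le (addStep s).1
      have h5 := rsize_bool_le (s.1 ^^ (s.2.1.bodd ^^ s.2.2.1.bodd))
      have h6 : rsize s = rsize s.1 + (rsize s.2.1 + (rsize s.2.2.1 + rsize s.2.2.2 + 1) + 1) + 1 := by
        rw [← rsize_pair, ← rsize_pair, ← rsize_pair]
      have h7 : rsize (addStep s) = rsize (addStep s).1 + (rsize s.2.1.div2 + (rsize s.2.2.1.div2 +
          (rsize (s.1 ^^ (s.2.1.bodd ^^ s.2.2.1.bodd)) + rsize s.2.2.2 + 1) + 1) + 1) + 1 := by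
        rw [← rsize_cons, ← rsize_pair, ← rsize_pair, ← rsize_pair]
        rfl
      rw [Polynomial.eval_ofNat]
      omega⟩
  refine (ofDigits (snd (snd (snd this)))).of_eq fun x => ?_
  obtain ⟨h1, h2⟩ := addStep_foldl (true :: ((a x).bits ++ (b x).bits)) (false, a x, b x, [])
  set t := (true :: ((a x).bits ++ (b x).bits)).foldl (fun s _ => addStep s) (false, a x, b x, [])
  simp only [List.length_nil, List.length_cons, List.length_append, Nat.size_eq_bits_len,
    ofDigitsMSB, List.foldl_nil, pow_zero, Bool.toNat_false, one_mul, zero_add] at h1 h2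
  -- The sum fits into the digits produced; thus the remaining multiple of the power of two in the
  -- invariant vanishes.
  have h3 : a x + b x < 2 ^ t.2.2.2.length := by
    have ha := (a x).lt_size_self
    have hb := (b x).lt_size_self
    have h4 : 2 ^ (a x).size ≤ 2 ^ ((a x).size + (b x).size) :=
      Nat.pow_le_pow_right (by norm_num) (by omega)
    have h5 : 2 ^ (b x).size ≤ 2 ^ ((a x).size + (b x).size) :=
      Nat.pow_le_pow_right (by norm_num) (by omega)
    rw [h1, pow_succ]
    omega
  rcases Nat.eq_zero_or_pos (t.1.toNat + t.2.1 + t.2.2.1) with h0 | h0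
  · rw [h0] at h2
    simpa [ofDigitsMSB] using h2
  · have := Nat.le_mul_of_pos_right (2 ^ t.2.2.2.length) h0
    omega

/-- The digits are read from the least significant end, so a later difference overrides an earlier
one. Invariant: the unread part of the first number is smaller, or both are equal and the flag is
set. -/
theorem lt_foldl {α : Type} (l : List α) (s : Bool × ℕ × ℕ) :
    let f : Bool × ℕ × ℕ → Bool × ℕ × ℕ := fun s =>
      (bif s.2.1.bodd ^^ s.2.2.bodd then s.2.2.bodd else s.1, s.2.1.div2, s.2.2.div2)
    let t := l.foldl (fun s _ => f s) s
    t.2.1 = s.2.1 / 2 ^ l.length ∧ t.2.2 = s.2.2 / 2 ^ l.length ∧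
      ((t.2.1 < t.2.2 ∨ t.2.1 = t.2.2 ∧ t.1 = true) ↔
        (s.2.1 < s.2.2 ∨ s.2.1 = s.2.2 ∧ s.1 = true)) := by
  intro f
  induction l generalizing s with
  | nil => simp
  | cons x l ih =>
    obtain ⟨h1, h2, h3⟩ := ih (f s)
    rw [List.foldl_cons, List.length_cons, pow_succ', ← Nat.div_div_eq_div_mul,
      ← Nat.div_div_eq_div_mul, ← Nat.div2_val, ← Nat.div2_val]
    refine ⟨h1, h2, h3.trans ?_⟩
    obtain ⟨c, a, b⟩ := s
    have ha := Nat.bodd_add_div2 a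
    have hb := Nat.bodd_add_div2 b
    simp only [f]
    cases c <;> cases ea : a.bodd <;> cases eb : b.bodd <;> simp [ea, eb] at ha hb ⊢ <;> omega

theorem lt {a b : γ → ℕ} (ha : Feasible a) (hb : Feasible b) :
    Feasible fun x => decide (a x < b x) := by
  have h1 : Feasible fun s : Bool × ℕ × ℕ => s.2.1.bodd := bodd (fst (snd id))
  have h2 : Feasible fun s : Bool × ℕ × ℕ => s.2.2.bodd := bodd (snd (snd id))
  have hstep : Feasible fun s : Bool × ℕ × ℕ =>
      (bif s.2.1.bodd ^^ s.2.2.bodd then s.2.2.bodd else s.1, s.2.1.div2, s.2.2.div2) :=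
    pair (cond (xor h1 h2) h2 (fst id)) (pair (div2 (fst (snd id))) (div2 (snd (snd id))))
  have := foldl_of_growth (l := fun x => (a x).bits ++ (b x).bits)
    (s := fun x => (false, a x, b x)) (f := fun _ (s : Bool × ℕ × ℕ) _ =>
      (bif s.2.1.bodd ^^ s.2.2.bodd then s.2.2.bodd else s.1, s.2.1.div2, s.2.2.div2))
    (append (bits ha) (bits hb)) (pair (const false) (pair ha hb))
    (hstep.comp (fst (snd id))) ⟨3, fun x s _ _ => by
      obtain ⟨c, a, b⟩ := s
      have h1 := rsize_div2_le a
      have h2 := rsize_div2_le b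
      have h3 := rsize_bool_le (bif a.bodd ^^ b.bodd then b.bodd else c)
      simp only [rsize_pair, Polynomial.eval_ofNat]
      omega⟩
  refine (fst this).of_eq fun x => ?_
  obtain ⟨h1, h2, h3⟩ := lt_foldl ((a x).bits ++ (b x).bits) (false, a x, b x)
  rw [List.length_append, Nat.size_eq_bits_len, Nat.size_eq_bits_len,
    Nat.div_eq_of_lt] at h1 h2
  · rw [h1, h2] at h3
    simp only [lt_self_iff_false, true_and, false_or, Bool.false_eq_true, and_false,
      or_false] at h3
    rw [Bool.eq_iff_iff, decide_eq_true_iff]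
    exact h3
  · exact (b x).lt_size_self.trans_le (Nat.pow_le_pow_right (by norm_num) (by omega))
  · exact (a x).lt_size_self.trans_le (Nat.pow_le_pow_right (by norm_num) (by omega))

theorem natEq {a b : γ → ℕ} (ha : Feasible a) (hb : Feasible b) :
    Feasible fun x => decide (a x = b x) :=
  (and (not (lt ha hb)) (not (lt hb ha))).of_eq fun x => by
    rw [Bool.eq_iff_iff]
    simp
    omega

/-- Left folds with numbers as states whose binary lengths grow by a polynomial amount. -/
theorem foldl_nat {α : Type} [TreeRep α] {l : γ → List α} {s : γ → ℕ} {f : γ → ℕ → α → ℕ}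
    (hl : Feasible l) (hs : Feasible s) (hf : Feasible fun x : γ × ℕ × α => f x.1 x.2.1 x.2.2)
    (hP : ∃ P : Polynomial ℕ, ∀ x s, ∀ a ∈ l x, (f x s a).size ≤ s.size + P.eval (rsize x)) :
    Feasible fun x => (l x).foldl (f x) (s x) := by
  obtain ⟨P, hP⟩ := hP
  obtain ⟨q, hq⟩ := hl.rsize_le
  obtain ⟨r, hr⟩ := hs.rsize_le
  refine foldl hl hs hf ⟨4 * (r + q * P) + 1, fun x l₁ l₂ e => ?_⟩
  have key : ∀ (l' : List α) s, (∀ a ∈ l', a ∈ l x) →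
      (l'.foldl (f x) s).size ≤ s.size + l'.length * P.eval (rsize x) := by
    intro l'
    induction l' with
    | nil => simp
    | cons a l' ih =>
      intro s h
      have h1 := ih (f x s a) fun b hb => h b (List.mem_cons_of_mem _ hb)
      have h2 := hP x s a (h a List.mem_cons_self)
      rw [List.foldl_cons, List.length_cons, Nat.succ_mul]
      omega
  have h1 := key l₁ (s x) fun a ha => by rw [e]; exact List.mem_append_left _ ha
  have h2 : l₁.length ≤ q.eval (rsize x) := by
    have h3 := (length_le_rsize (l x)).trans (hq x)
    have h4 : l₁.length ≤ (l x).length := by rw [e]; simp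
    omega
  have h3 := Nat.mul_le_mul_right (P.eval (rsize x)) h2
  have h4 := (size_le_rsize _).trans (hr x)
  have h5 := rsize_nat_le (l₁.foldl (f x) (s x))
  simp only [Polynomial.eval_add, Polynomial.eval_mul, Polynomial.eval_ofNat, Polynomial.eval_one]
  omega

theorem size_add_le (a b : ℕ) : (a + b).size ≤ a.size + b.size + 1 := by
  rw [Nat.size_le]
  have ha := a.lt_size_self
  have hb := b.lt_size_self
  have h4 : 2 ^ a.size ≤ 2 ^ (a.size + b.size) := Nat.pow_le_pow_right (by norm_num) (by omega)
  have h5 : 2 ^ b.size ≤ 2 ^ (a.size + b.size) := Nat.pow_le_pow_right (by norm_num) (by omega)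
  rw [pow_succ]
  omega

theorem sum {l : γ → List ℕ} (hl : Feasible l) : Feasible fun x => (l x).sum := by
  obtain ⟨q, hq⟩ := hl.rsize_le
  refine (foldl_nat (f := fun _ s a => s + a) (s := fun _ => 0) hl (const 0)
    (add (fst (snd id)) (snd (snd id))) ⟨q + 1, fun x s a ha => ?_⟩).of_eq fun x =>
      (List.sum_eq_foldl).symm
  have h1 := size_add_le s a
  have h2 := (size_le_rsize a).trans ((rsize_mem_le ha).trans (hq x))
  rw [Polynomial.eval_add, Polynomial.eval_one]
  omega

/-- Horner's scheme on the digits of `a`, most significant digit first: double the state and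
possibly add `b`. Each step adds to the number of digits only an amount polynomial in the input
size. -/
theorem mul {a b : γ → ℕ} (ha : Feasible a) (hb : Feasible b) : Feasible fun x => a x * b x := by
  obtain ⟨q, hq⟩ := hb.rsize_le
  refine (foldl_nat (l := fun x => (a x).bits.reverse)
    (f := fun x s d => Nat.bit false s + bif d then b x else 0) (s := fun _ => 0)
    (reverse (bits ha)) (const 0) (add (bit (const false) (fst (snd id)))
      (cond (snd (snd id)) (hb.comp (fst id)) (const 0))) ⟨q + 3, fun x s d _ => ?_⟩).of_eq
        fun x => ?_
  · have h1 := size_add_le (Nat.bit false s) (bif d then b x else 0)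
    have h2 : (bif d then b x else 0).size ≤ (b x).size := by cases d <;> simp
    have h3 := (size_le_rsize _).trans (hq x)
    have h4 : (Nat.bit false s).size ≤ s.size + 1 := by
      rw [Nat.size_le, Nat.bit_val, pow_succ]
      have := s.lt_size_self
      simp
      omega
    simp only [Polynomial.eval_add, Polynomial.eval_ofNat]
    omega
  · have key : ∀ (l : List Bool) n, l.foldl (fun s d => Nat.bit false s + bif d then b x else 0)
        (n * b x) = l.foldl (fun n d => Nat.bit d n) n * b x := by
      intro l
      induction l with
      | nil => simp
      | cons d l ih =>
        intro n
        rw [List.foldl_cons, List.foldl_cons, ← ih]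
        congr 1
        rw [Nat.bit_val, Nat.bit_val]
        cases d <;> simp <;> ring
    have := key (a x).bits.reverse 0
    rw [zero_mul] at this
    rw [this]
    exact congrArg (· * b x) (ofDigitsMSB_reverse_bits _)

end

end Feasible

open Cmd Data

/-! ### From programs to Turing machines -/

namespace Cmd

/-- Turn the content of the input stack into the representation of a list on the main stack. -/
def load : Cmd :=
  transfer .input .aux₁ ;; push .main false ;; loop .aux₁ (push .main false ;; push .main true)
    (push .main false ;; push .main false ;; push .main true ;; push .main true)

/-- Write the list that is represented on the main stack to the output stack. -/
def unload : Cmd :=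
  push .flag false ;; loop .flag (pop .main skip skip (pop .main skip
    (push .aux₁ false ;; push .flag false)
    (pop .main skip (pop .main skip (push .aux₁ true ;; push .flag false) skip) skip))) skip ;;
  loop .aux₁ (emit false) (emit true)

end Cmd

theorem exec_load (l : List Bool) :
    Exec load ⟨[], [], [], [], [], [], l, []⟩ (7 * l.length + 3) (.idle (rcode l) [] []) := by
  have h1 := exec_transfer (w := .input) (w' := .aux₁) (fun l l' => ⟨[], l', [], [], [], [], l, []⟩)
    (fun _ _ => rfl) (fun _ _ => rfl) (fun _ _ _ => rfl) (fun _ _ _ => rfl) l []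
  have key : ∀ l r : List Bool, Exec (loop .aux₁ (push .main false ;; push .main true)
      (push .main false ;; push .main false ;; push .main true ;; push .main true))
      ⟨rcode r, l, [], [], [], [], [], []⟩ (5 * l.length + 1)
      (.idle (rcode (l.reverse ++ r)) [] []) := by
    intro l
    induction l with
    | nil => exact fun r => .loopNil rfl
    | cons b l ih =>
      intro r
      have H := ih (b :: r)
      rw [List.reverse_cons, List.append_assoc]
      cases b with
      | false =>
        exact (Exec.loopFalse rfl (Exec.push.seq Exec.push) H).mono
          (by rw [List.length_cons]; omega)
      | true =>
        exact (Exec.loopTrue rfl (Exec.push.seq (Exec.push.seq (Exec.push.seq Exec.push))) H).mono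
          (by rw [List.length_cons]; omega)
  have h2 := key (l.reverse ++ []) []
  simp only [List.append_nil, List.length_reverse, List.reverse_reverse] at h1 h2
  exact (h1.seq (Exec.push.seq h2)).mono (by omega)

theorem exec_unload (l : List Bool) :
    Exec unload (.idle (rcode l) [] []) (10 * l.length + 10)
      ⟨[], [], [], [], [], [], [], l⟩ := by
  have key : ∀ l r : List Bool, Exec (loop .flag (pop .main skip skip (pop .main skip
      (push .aux₁ false ;; push .flag false) (pop .main skip
        (pop .main skip (push .aux₁ true ;; push .flag false) skip) skip))) skip)
      ⟨rcode l, r, [], [], [], [false], [], []⟩ (7 * l.length + 4)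
      ⟨[], l.reverse ++ r, [], [], [], [], [], []⟩ := by
    intro l
    induction l with
    | nil =>
      exact fun r => (Exec.loopFalse rfl (Exec.popFalse rfl .skip) (.loopNil rfl)).mono (by simp)
    | cons b l ih =>
      intro r
      have H := ih (b :: r)
      rw [List.reverse_cons, List.append_assoc]
      cases b with
      | false =>
        exact (Exec.loopFalse rfl (Exec.popTrue rfl (Exec.popFalse rfl
          (Exec.push.seq Exec.push))) H).mono (by rw [List.length_cons]; omega)
      | true =>
        exact (Exec.loopFalse rfl (Exec.popTrue rfl (Exec.popTrue rfl (Exec.popFalse rfl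
          (Exec.popFalse rfl (Exec.push.seq Exec.push))))) H).mono
          (by rw [List.length_cons]; omega)
  have key' : ∀ l r : List Bool, Exec (loop .aux₁ (emit false) (emit true))
      ⟨[], l, [], [], [], [], [], r⟩ (2 * l.length + 1)
      ⟨[], [], [], [], [], [], [], l.reverse ++ r⟩ := by
    intro l
    induction l with
    | nil => exact fun r => .loopNil rfl
    | cons b l ih =>
      intro r
      have H := ih (b :: r)
      rw [List.reverse_cons, List.append_assoc]
      cases b with
      | false => exact (Exec.loopFalse rfl .emit H).mono (by rw [List.length_cons]; omega)
      | true => exact (Exec.loopTrue rfl .emit H).mono (by rw [List.length_cons]; omega)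
  have h1 := key l []
  have h2 := key' (l.reverse ++ []) []
  simp only [List.append_nil, List.length_reverse, List.reverse_reverse] at h1 h2
  exact (Exec.push.seq (h1.seq h2)).mono (by omega)

/-- Feasible functions on strings are computed by Turing machines in polynomial time. -/
theorem Feasible.polyTime {α β B : Type} {ea : α → List Bool} {eb : β → List B} {g : α → β}
    {f : List Bool → List Bool} (hf : Feasible f) (φ : Bool → B)
    (h : ∀ a, (f (ea a)).map φ = eb (g a)) : PolyTime ea eb g := by
  obtain ⟨q, hq⟩ := hf.rsize_le
  obtain ⟨c, p, hc⟩ := hf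
  -- Each bit contributes a tree of size at most three and one node; the end of the list contributes
  -- the summand one.
  let r : Polynomial ℕ := 4 * .X + 1
  refine polyTime_of_exec φ (load ;; c ;; unload)
    (7 * .X + 3 + p.comp r + 10 * q.comp r + 10) (fun a => f (ea a)) h fun a => ?_
  have h2 := hc (ea a) [] [] []
  rw [List.append_nil, List.append_nil] at h2
  refine ((exec_load _).seq (h2.seq (exec_unload _))).mono ?_
  have hr : rsize (ea a) ≤ r.eval (ea a).length := by
    generalize ea a = l
    simp only [r, Polynomial.eval_add, Polynomial.eval_mul, Polynomial.eval_ofNat,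
      Polynomial.eval_X, Polynomial.eval_one]
    induction l with
    | nil => simp
    | cons b l ih => have := rsize_bool_le b; simp; omega
  have h3 := p.eval_mono_nat hr
  have h4 := (length_le_rsize _).trans ((hq (ea a)).trans (q.eval_mono_nat hr))
  simp only [Polynomial.eval_add, Polynomial.eval_mul, Polynomial.eval_ofNat, Polynomial.eval_X,
    Polynomial.eval_comp]
  omega

/-! ### The algorithm -/

namespace CliqueColouring

/-- Split a word into its leading block of ones and the part after the first zero. -/
def splitStep (s : Bool × List Bool × List Bool) (b : Bool) : Bool × List Bool × List Bool :=
  bif s.1 then (true, s.2.1, b :: s.2.2) else bif b then (false, true :: s.2.1, []) else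
    (true, s.2)

/-- The leading ones and the reversed remainder of a word. -/
def split (w : List Bool) : List Bool × List Bool := (w.foldl splitStep (false, [], [])).2

/-- The vertices of an encoded graph. -/
def vertices (w : List Bool) : List ℕ := List.range (split w).1.length

/-- The edges of an encoded graph. -/
def edges (w : List Bool) : List (ℕ × ℕ) :=
  ((((vertices w).flatMap fun u => (vertices w).map fun v => (u, v)).zip
    (split w).2.reverse).filter fun e => e.2).map fun e => e.1

/-- Membership in a list of edges. -/
def hasEdge (E : List (ℕ × ℕ)) (u v : ℕ) : Bool :=
  E.any fun e => decide (e.1 = u) && decide (e.2 = v)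

/-- All tuples of vertices with edges in both directions between any two entries. -/
def cliques (V : List ℕ) (E : List (ℕ × ℕ)) : ℕ → List (List ℕ)
  | 0 => [List.nil]
  | j + 1 => (cliques V E j).flatMap fun t =>
      (V.filter fun v => t.all fun u => hasEdge E u v && hasEdge E v u).map fun v => v :: t

/-- The number of occurrences of a vertex in a tuple. -/
def occ (t : List ℕ) (u : ℕ) : ℕ := (t.map fun v => if v = u then 1 else 0).sum

/-- The Gram matrix of the occurrence vectors of the tuples. -/
def gram (T : List (List ℕ)) (V : List ℕ) : List (List ℕ) :=
  V.map fun u => V.map fun v => (T.map fun t => occ t u * occ t v).sum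

/-- The identity matrix. -/
def identity (V : List ℕ) : List (List ℕ) := V.map fun u => V.map fun v => if u = v then 1 else 0

/-- The scalar product. -/
def dot (a b : List ℕ) : ℕ := (List.zipWith (fun x y => x * y) a b).sum

/-- The product of a matrix, given by its rows, and the transpose of another one. -/
def mulRows (A B : List (List ℕ)) : List (List ℕ) := A.map fun a => B.map fun b => dot a b

/-- The sum of two matrices. -/
def addRows (A B : List (List ℕ)) : List (List ℕ) :=
  List.zipWith (fun a b => List.zipWith (fun x y => x + y) a b) A B

/-- A multiple of a matrix. -/
def smulRows (c : ℕ) (A : List (List ℕ)) : List (List ℕ) := A.map fun a => a.map fun x => c * x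

/-- The Frobenius inner product of two matrices. -/
def frob (A B : List (List ℕ)) : ℕ := (List.zipWith (fun a b => dot a b) A B).sum

/-- The matrix `K * P + tr (M * Q) * I` for symmetric matrices. -/
def update (M I K P Q : List (List ℕ)) : List (List ℕ) :=
  addRows (mulRows K P) (smulRows (frob M Q) I)

/-- One step of the division-free method of Faddeev and LeVerrier for the matrix `M`, where the
current matrix is `P - Q` and a step to a matrix with trace zero is suppressed. -/
def traceStep (M I : List (List ℕ)) (s : List (List ℕ) × List (List ℕ) × List (List ℕ)) :
    List (List ℕ) × List (List ℕ) × List (List ℕ) :=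
  (addRows s.1 M, if frob I (update M I s.1 s.2.1 s.2.2) = frob I (update M I s.1 s.2.2 s.2.1)
    then s.2 else (update M I s.1 s.2.1 s.2.2, update M I s.1 s.2.2 s.2.1))

/-- A multiple of the orthogonal projection onto the kernel of `M`, as a difference. -/
def kernelMatrix (M : List (List ℕ)) (V : List ℕ) : List (List ℕ) × List (List ℕ) :=
  (V.foldl (fun s _ => traceStep M (identity V) s)
    (M, identity V, smulRows 0 (identity V))).2

/-- The sign of the last nonzero entry of the difference of two rows. -/
def rowSign (p q : List ℕ) : Bool :=
  (p.zip q).foldl (fun s e => if e.1 < e.2 then false else if e.2 < e.1 then true else s) true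

/-- The colouring found by the algorithm. -/
def colours (l : ℕ) (w : List Bool) : List Bool :=
  List.zipWith rowSign
    (kernelMatrix (gram (cliques (vertices w) (edges w) l) (vertices w)) (vertices w)).1
    (kernelMatrix (gram (cliques (vertices w) (edges w) l) (vertices w)) (vertices w)).2

/-- Whether a tuple has an entry with colour `b`. -/
def hasColour (V : List ℕ) (C : List Bool) (t : List ℕ) (b : Bool) : Bool :=
  (V.zip C).any fun e => !(e.2 ^^ b) && decide (0 < occ t e.1)

/-- Whether the colouring found by the algorithm is proper. -/
def verify (l : ℕ) (w : List Bool) : Bool :=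
  (cliques (vertices w) (edges w) l).all fun t =>
    hasColour (vertices w) (colours l w) t true && hasColour (vertices w) (colours l w) t false

/-! ### The algorithm runs in polynomial time -/

open Feasible

section

variable {γ : Type} [TreeRep γ]

theorem feasible_split : Feasible split := by
  have hstep : Feasible fun x : List Bool × (Bool × List Bool × List Bool) × Bool =>
      splitStep x.2.1 x.2.2 :=
    .cond (.fst (.fst (.snd .id)))
      (.pair (.const true) (.pair (.fst (.snd (.fst (.snd .id))))
        (.cons (.snd (.snd .id)) (.snd (.snd (.fst (.snd .id)))))))
      (.cond (.snd (.snd .id))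
        (.pair (.const false) (.pair (.cons (.const true) (.fst (.snd (.fst (.snd .id))))) .nil))
        (.pair (.const true) (.snd (.fst (.snd .id)))))
  refine .snd (.foldl_of_growth (s := fun _ => (false, [], [])) (f := fun _ => splitStep) .id
    (.const _) hstep ⟨7, fun x s b _ => ?_⟩)
  obtain ⟨c, l, l'⟩ := s
  have h1 := rsize_bool_le b
  have h2 := rsize_bool_le true
  have h3 := rsize_bool_le false
  have h4 := rsize_pos c
  have h5 := rsize_pos l'
  rw [Polynomial.eval_ofNat]
  cases c <;> cases b <;> simp [splitStep] <;> omega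

theorem rsize_list_le {α : Type} [TreeRep α] {l : List α} {c : ℕ} (h : ∀ a ∈ l, rsize a ≤ c) :
    rsize l ≤ l.length * (c + 1) + 1 := by
  induction l with
  | nil => simp
  | cons a l ih =>
    have h1 := h a List.mem_cons_self
    have h2 := ih fun b hb => h b (List.mem_cons_of_mem _ hb)
    rw [rsize_cons, List.length_cons, Nat.add_one_mul]
    omega

theorem rsize_nat_le' (n : ℕ) : rsize n ≤ 4 * n + 1 := by
  have h1 := rsize_nat_le n
  have h2 : n.size ≤ n := Nat.size_le.2 Nat.lt_two_pow_self
  omega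

theorem feasible_range {α : Type} [TreeRep α] {l : γ → List α} (hl : Feasible l) :
    Feasible fun x => List.range (l x).length := by
  have key : ∀ l : List α, l.foldl (fun (s : ℕ × List ℕ) _ => (s.1 + 1, s.1 :: s.2)) (0, []) =
      (l.length, (List.range l.length).reverse) := by
    intro l
    induction l using List.reverseRecOn with
    | nil => rfl
    | append_singleton l a ih => simp [ih, List.range_succ]
  obtain ⟨q, hq⟩ := hl.rsize_le
  have := Feasible.foldl (s := fun _ => (0, [])) (f := fun _ (s : ℕ × List ℕ) _ =>
    (s.1 + 1, s.1 :: s.2)) hl (.const _) (.pair (.add (.fst (.fst (.snd .id))) (.const 1))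
      (.cons (.fst (.fst (.snd .id))) (.snd (.fst (.snd .id)))))
    ⟨4 * q + 1 + (q * (4 * q + 1 + 1) + 1) + 1, fun x l₁ l₂ e => by
      have h1 : l₁.length ≤ q.eval (rsize x) := by
        have h3 := (length_le_rsize (l x)).trans (hq x)
        have h4 : l₁.length ≤ (l x).length := by rw [e]; simp
        omega
      have h2 : rsize (List.range l₁.length).reverse ≤
          q.eval (rsize x) * (4 * q.eval (rsize x) + 1 + 1) + 1 := by
        refine (rsize_list_le (c := 4 * q.eval (rsize x) + 1) fun a ha => ?_).trans ?_
        · have h3 := rsize_nat_le' a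
          simp at ha
          omega
        · rw [List.length_reverse, List.length_range]
          gcongr
      rw [key, rsize_pair]
      have h3 := rsize_nat_le' l₁.length
      simp only [Polynomial.eval_add, Polynomial.eval_mul, Polynomial.eval_ofNat,
        Polynomial.eval_one]
      omega⟩
  refine (reverse (.snd this)).of_eq fun x => ?_
  rw [key]
  simp

theorem feasible_vertices : Feasible vertices := feasible_range (.fst feasible_split)

theorem feasible_edges : Feasible edges := by
  have h1 : Feasible fun w => (vertices w).flatMap fun u => (vertices w).map fun v => (u, v) :=
    .flatMap (g := fun w u => (vertices w).map fun v => (u, v)) feasible_vertices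
      (.map (g := fun (x : List Bool × ℕ) v => (x.2, v)) (feasible_vertices.comp (.fst .id))
        (.pair (.snd (.fst .id)) (.snd .id)))
  exact .map (g := fun _ (e : (ℕ × ℕ) × Bool) => e.1) (.filter (p := fun _ e => e.2)
    (.zip h1 (.reverse (.snd feasible_split))) (.snd (.snd .id))) (.fst (.snd .id))

theorem feasible_hasEdge {E : γ → List (ℕ × ℕ)} {u v : γ → ℕ} (hE : Feasible E) (hu : Feasible u)
    (hv : Feasible v) : Feasible fun x => hasEdge (E x) (u x) (v x) :=
  .any hE (.and (.natEq (.fst (.snd .id)) (hu.comp (.fst .id)))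
    (.natEq (.snd (.snd .id)) (hv.comp (.fst .id))))

/-- The length `j` is fixed and not part of the input. The induction is on the programs: each
further entry adds one nested pass over the vertices and changes the polynomial. -/
theorem feasible_cliques {V : γ → List ℕ} {E : γ → List (ℕ × ℕ)} (hV : Feasible V)
    (hE : Feasible E) (j : ℕ) : Feasible fun x => cliques (V x) (E x) j := by
  induction j with
  | zero => exact .const _
  | succ j ih =>
    have hE' : Feasible fun y : ((γ × List ℕ) × ℕ) × ℕ => E y.1.1.1 :=
      hE.comp (.fst (.fst (.fst .id)))
    exact .flatMap (g := fun x t => ((V x).filter fun v => t.all fun u =>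
      hasEdge (E x) u v && hasEdge (E x) v u).map fun v => v :: t) ih
      (.map (g := fun (y : γ × List ℕ) v => v :: y.2) (.filter (p := fun (y : γ × List ℕ) v =>
        y.2.all fun u => hasEdge (E y.1) u v && hasEdge (E y.1) v u) (hV.comp (.fst .id)) (.all (.snd (.fst .id))
      (.and (feasible_hasEdge hE' (.snd .id) (.snd (.fst .id)))
        (feasible_hasEdge hE' (.snd (.fst .id)) (.snd .id)))))
      (.cons (.snd .id) (.snd (.fst .id))))

theorem feasible_occ {t : γ → List ℕ} {u : γ → ℕ} (ht : Feasible t) (hu : Feasible u) :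
    Feasible fun x => occ (t x) (u x) :=
  .sum (.map ht (.ite (.natEq (.snd .id) (hu.comp (.fst .id))) (.const 1) (.const 0)))

theorem feasible_gram {T : γ → List (List ℕ)} {V : γ → List ℕ} (hT : Feasible T)
    (hV : Feasible V) : Feasible fun x => gram (T x) (V x) :=
  .map hV (.map (hV.comp (.fst .id)) (.sum (.map (hT.comp (.fst (.fst .id)))
    (.mul (feasible_occ (.snd .id) (.snd (.fst (.fst .id))))
      (feasible_occ (.snd .id) (.snd (.fst .id)))))))

theorem feasible_identity {V : γ → List ℕ} (hV : Feasible V) :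
    Feasible fun x => identity (V x) :=
  .map hV (.map (hV.comp (.fst .id)) (.ite (.natEq (.snd (.fst .id)) (.snd .id)) (.const 1)
    (.const 0)))

theorem feasible_dot {a b : γ → List ℕ} (ha : Feasible a) (hb : Feasible b) :
    Feasible fun x => dot (a x) (b x) :=
  .sum (.zipWith ha hb (.mul (.fst (.snd .id)) (.snd (.snd .id))))

variable {A B : γ → List (List ℕ)}

theorem feasible_mulRows (hA : Feasible A) (hB : Feasible B) :
    Feasible fun x => mulRows (A x) (B x) :=
  .map hA (.map (hB.comp (.fst .id)) (feasible_dot (.snd (.fst .id)) (.snd .id)))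

theorem feasible_addRows (hA : Feasible A) (hB : Feasible B) :
    Feasible fun x => addRows (A x) (B x) :=
  .zipWith hA hB (.zipWith (.fst (.snd .id)) (.snd (.snd .id))
    (.add (.fst (.snd .id)) (.snd (.snd .id))))

theorem feasible_smulRows {c : γ → ℕ} (hc : Feasible c) (hA : Feasible A) :
    Feasible fun x => smulRows (c x) (A x) :=
  .map hA (.map (.snd .id) (.mul (hc.comp (.fst (.fst .id))) (.snd .id)))

theorem feasible_frob (hA : Feasible A) (hB : Feasible B) : Feasible fun x => frob (A x) (B x) :=
  .sum (.zipWith hA hB (feasible_dot (.fst (.snd .id)) (.snd (.snd .id))))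

theorem feasible_update {M I K P Q : γ → List (List ℕ)} (hM : Feasible M) (hI : Feasible I)
    (hK : Feasible K) (hP : Feasible P) (hQ : Feasible Q) :
    Feasible fun x => update (M x) (I x) (K x) (P x) (Q x) :=
  feasible_addRows (feasible_mulRows hK hP) (feasible_smulRows (feasible_frob hM hQ) hI)

/-- At most `r` rows of length at most `r` whose entries have at most `L` binary digits. -/
def Bounded (r L : ℕ) (A : List (List ℕ)) : Prop :=
  A.length ≤ r ∧ ∀ a ∈ A, a.length ≤ r ∧ ∀ x ∈ a, x < 2 ^ L

/-! ### Growth of the number of digits under matrix operations. -/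

namespace Bounded

theorem mono {r L L' : ℕ} {A : List (List ℕ)} (h : Bounded r L A) (hL : L ≤ L') :
    Bounded r L' A :=
  ⟨h.1, fun a ha => ⟨(h.2 a ha).1, fun x hx => ((h.2 a ha).2 x hx).trans_le
    (Nat.pow_le_pow_right (by norm_num) hL)⟩⟩

theorem of_rsize_le {A : List (List ℕ)} {r : ℕ} (h : rsize A ≤ r) : Bounded r r A :=
  ⟨(length_le_rsize A).trans h, fun a ha => ⟨(length_le_rsize a).trans ((rsize_mem_le ha).trans h),
    fun x hx => x.lt_size_self.trans_le (Nat.pow_le_pow_right (by norm_num)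
      ((size_le_rsize x).trans ((rsize_mem_le hx).trans ((rsize_mem_le ha).trans h))))⟩⟩

theorem rsize_le {r L : ℕ} {A : List (List ℕ)} (h : Bounded r L A) :
    rsize A ≤ r * (r * (4 * L + 2) + 2) + 1 := by
  refine (rsize_list_le (c := r * (4 * L + 2) + 1) fun a ha => ?_).trans ?_
  · obtain ⟨h1, h2⟩ := h.2 a ha
    refine (rsize_list_le (c := 4 * L + 1) fun x hx => ?_).trans ?_
    · have h3 := rsize_nat_le x
      have h4 := Nat.size_le.2 (h2 x hx)
      omega
    · gcongr
  · have := h.1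
    gcongr

theorem sum_lt {l : List ℕ} {r L : ℕ} (hl : l.length ≤ r) (h : ∀ x ∈ l, x < 2 ^ L) :
    l.sum < 2 ^ (r + L) := by
  have h1 : l.sum ≤ l.length * 2 ^ L := by
    have := List.sum_le_card_nsmul l (2 ^ L) fun x hx => (h x hx).le
    simpa using this
  calc l.sum ≤ r * 2 ^ L := h1.trans (Nat.mul_le_mul_right _ hl)
    _ < 2 ^ r * 2 ^ L := Nat.mul_lt_mul_of_pos_right Nat.lt_two_pow_self (by positivity)
    _ = 2 ^ (r + L) := (pow_add _ _ _).symm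

theorem mem_zipWith {α β δ : Type} {g : α → β → δ} {l : List α} {l' : List β} {c : δ}
    (h : c ∈ List.zipWith g l l') : ∃ a ∈ l, ∃ b ∈ l', g a b = c := by
  rw [← List.map_uncurry_zip_eq_zipWith, List.mem_map] at h
  obtain ⟨⟨a, b⟩, h, rfl⟩ := h
  exact ⟨a, (List.of_mem_zip h).1, b, (List.of_mem_zip h).2, rfl⟩

theorem dot_lt {a b : List ℕ} {r L L' : ℕ} (hl : a.length ≤ r) (ha : ∀ x ∈ a, x < 2 ^ L)
    (hb : ∀ x ∈ b, x < 2 ^ L') : dot a b < 2 ^ (r + (L + L')) := by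
  refine sum_lt (by rw [List.length_zipWith]; omega) fun x hx => ?_
  obtain ⟨y, hy, z, hz, rfl⟩ := mem_zipWith hx
  rw [pow_add]
  exact Nat.mul_lt_mul'' (ha y hy) (hb z hz)

theorem mul {r L L' : ℕ} {A B : List (List ℕ)} (hA : Bounded r L A) (hB : Bounded r L' B) :
    Bounded r (r + (L + L')) (mulRows A B) := by
  refine ⟨by simpa [mulRows] using hA.1, fun a ha => ?_⟩
  obtain ⟨a, ha', rfl⟩ := List.mem_map.1 ha
  refine ⟨by simpa using hB.1, fun x hx => ?_⟩
  obtain ⟨b, hb, rfl⟩ := List.mem_map.1 hx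
  exact dot_lt (hA.2 a ha').1 (hA.2 a ha').2 (hB.2 b hb).2

theorem frob_lt {r L L' : ℕ} {A B : List (List ℕ)} (hA : Bounded r L A) (hB : Bounded r L' B) :
    frob A B < 2 ^ (r + (r + (L + L'))) := by
  refine sum_lt (by rw [List.length_zipWith]; have := hA.1; omega) fun x hx => ?_
  obtain ⟨a, ha, b, hb, rfl⟩ := mem_zipWith hx
  exact dot_lt (hA.2 a ha).1 (hA.2 a ha).2 (hB.2 b hb).2

theorem smul {r L L' c : ℕ} {A : List (List ℕ)} (hc : c < 2 ^ L) (hA : Bounded r L' A) :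
    Bounded r (L + L') (smulRows c A) := by
  refine ⟨by simpa [smulRows] using hA.1, fun a ha => ?_⟩
  obtain ⟨a, ha', rfl⟩ := List.mem_map.1 ha
  refine ⟨by simpa using (hA.2 a ha').1, fun x hx => ?_⟩
  obtain ⟨y, hy, rfl⟩ := List.mem_map.1 hx
  rw [pow_add]
  exact Nat.mul_lt_mul'' hc ((hA.2 a ha').2 y hy)

theorem add {r L : ℕ} {A B : List (List ℕ)} (hA : Bounded r L A) (hB : Bounded r L B) :
    Bounded r (L + 1) (addRows A B) := by
  refine ⟨by rw [addRows, List.length_zipWith]; have := hA.1; omega, fun a ha => ?_⟩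
  obtain ⟨a, ha', b, hb, rfl⟩ := mem_zipWith ha
  refine ⟨by rw [List.length_zipWith]; have := (hA.2 a ha').1; omega, fun x hx => ?_⟩
  obtain ⟨y, hy, z, hz, rfl⟩ := mem_zipWith hx
  have h1 := (hA.2 a ha').2 y hy
  have h2 := (hB.2 b hb).2 z hz
  rw [pow_succ]
  omega

/-- The digit counts of the factors only add up, so `L` enters with coefficient one. Hence the
length of the entries grows additively from step to step. -/
theorem update {r j L : ℕ} {M I K P Q : List (List ℕ)} (hM : Bounded r r M) (hI : Bounded r r I)
    (hK : Bounded r (r + j) K) (hP : Bounded r L P) (hQ : Bounded r L Q) :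
    Bounded r (4 * r + j + L + 1) (CliqueColouring.update M I K P Q) :=
  add ((mul hK hP).mono (by omega)) ((smul (frob_lt hM hQ) hI).mono (by omega))

end Bounded

/-- The state cannot be treated as growing by a bounded amount of tree size, since every entry grows
in every step. Dimensions and digits of the intermediate matrices are bounded instead. -/
theorem feasible_kernelMatrix {M : γ → List (List ℕ)} {V : γ → List ℕ} (hM : Feasible M)
    (hV : Feasible V) : Feasible fun x => kernelMatrix (M x) (V x) := by
  have hI : Feasible fun x => identity (V x) := feasible_identity hV
  obtain ⟨qM, hqM⟩ := hM.rsize_le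
  obtain ⟨qI, hqI⟩ := hI.rsize_le
  obtain ⟨qV, hqV⟩ := hV.rsize_le
  have hstep : Feasible fun y : γ × (List (List ℕ) × List (List ℕ) × List (List ℕ)) × ℕ =>
      traceStep (M y.1) (identity (V y.1)) y.2.1 := by
    have hM' : Feasible fun y : γ × (List (List ℕ) × List (List ℕ) × List (List ℕ)) × ℕ => M y.1 :=
      hM.comp (.fst .id)
    have hI' : Feasible fun y : γ × (List (List ℕ) × List (List ℕ) × List (List ℕ)) × ℕ =>
      identity (V y.1) := hI.comp (.fst .id)
    have hK : Feasible fun y : γ × (List (List ℕ) × List (List ℕ) × List (List ℕ)) × ℕ =>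
      y.2.1.1 := .fst (.fst (.snd .id))
    have hP : Feasible fun y : γ × (List (List ℕ) × List (List ℕ) × List (List ℕ)) × ℕ =>
      y.2.1.2.1 := .fst (.snd (.fst (.snd .id)))
    have hQ : Feasible fun y : γ × (List (List ℕ) × List (List ℕ) × List (List ℕ)) × ℕ =>
      y.2.1.2.2 := .snd (.snd (.fst (.snd .id)))
    have h1 := feasible_update hM' hI' hK hP hQ
    have h2 := feasible_update hM' hI' hK hQ hP
    exact .pair (feasible_addRows hK hM') (.ite (.natEq (feasible_frob hI' h1)
      (feasible_frob hI' h2)) (.snd (.fst (.snd .id))) (.pair h1 h2))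
  -- After `j ≤ r` steps the first matrix has entries of at most `r + j` digits, so `Bounded.update`
  -- adds at most `5 * r + 1` digits to the other two.
  have hbound : ∀ (r : ℕ) (M I : List (List ℕ)) (_ : Bounded r r M) (_ : Bounded r r I)
      (l : List ℕ), l.length ≤ r →
      let s := l.foldl (fun s _ => traceStep M I s) (M, I, smulRows 0 I)
      Bounded r (r + l.length) s.1 ∧ Bounded r (r + l.length * (5 * r + 1)) s.2.1 ∧
        Bounded r (r + l.length * (5 * r + 1)) s.2.2 := by
    intro r M I hM hI l
    induction l using List.reverseRecOn with
    | nil =>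
      intro _
      exact ⟨hM.mono (by simp), hI.mono (by simp),
        (Bounded.smul (L := 0) (by norm_num) hI).mono (by simp)⟩
    | append_singleton l a ih =>
      intro hl
      rw [List.length_append, List.length_singleton] at hl ⊢
      obtain ⟨h1, h2, h3⟩ := ih (by omega)
      rw [List.foldl_append]
      dsimp only [List.foldl_cons, List.foldl_nil, traceStep]
      have e : r + (l.length + 1) * (5 * r + 1) = r + l.length * (5 * r + 1) + (5 * r + 1) := by
        ring
      rw [e]
      refine ⟨Bounded.add h1 (hM.mono (Nat.le_add_right r l.length)), ?_⟩
      split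
      · exact ⟨h2.mono (by omega), h3.mono (by omega)⟩
      · exact ⟨(Bounded.update hM hI h1 h2 h3).mono (by omega),
          (Bounded.update hM hI h1 h3 h2).mono (by omega)⟩
  -- `R` bounds the dimensions, the digits of `M` and of the identity, and the number of steps. `E`
  -- bounds the digits of all intermediate entries.
  let R : Polynomial ℕ := qM + qI + qV
  let E : Polynomial ℕ := R + R * (5 * R + 1)
  refine .snd (.foldl (f := fun x s _ => traceStep (M x) (identity (V x)) s) hV
    (.pair hM (.pair hI (feasible_smulRows (.const 0) hI))) hstep
    ⟨3 * (R * (R * (4 * E + 2) + 2) + 1) + 2, fun x l₁ l₂ e => ?_⟩)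
  set r := R.eval (rsize x) with hr
  have hr' : r = qM.eval (rsize x) + qI.eval (rsize x) + qV.eval (rsize x) := by
    simp only [hr, R, Polynomial.eval_add]
  have h4 : l₁.length ≤ r := by
    have h1 := (length_le_rsize (V x)).trans (hqV x)
    have h2 : l₁.length ≤ (V x).length := by rw [e]; simp
    omega
  obtain ⟨h1, h2, h3⟩ := hbound r (M x) (identity (V x))
    (.of_rsize_le ((hqM x).trans (by omega))) (.of_rsize_le ((hqI x).trans (by omega))) l₁ h4
  set s := l₁.foldl (fun s _ => traceStep (M x) (identity (V x)) s)
    (M x, identity (V x), smulRows 0 (identity (V x)))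
  have h5 : l₁.length * (5 * r + 1) ≤ r * (5 * r + 1) := Nat.mul_le_mul_right _ h4
  have h6 : r ≤ r * (5 * r + 1) := Nat.le_mul_of_pos_right _ (by omega)
  have b1 := (h1.mono (L' := r + r * (5 * r + 1)) (by omega)).rsize_le
  have b2 := (h2.mono (L' := r + r * (5 * r + 1)) (by omega)).rsize_le
  have b3 := (h3.mono (L' := r + r * (5 * r + 1)) (by omega)).rsize_le
  have hs : rsize s = rsize s.1 + (rsize s.2.1 + rsize s.2.2 + 1) + 1 := by
    rw [← rsize_pair, ← rsize_pair]
  simp only [Polynomial.eval_add, Polynomial.eval_mul, Polynomial.eval_ofNat, Polynomial.eval_one,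
    ← hr, E]
  omega

theorem feasible_rowSign {p q : γ → List ℕ} (hp : Feasible p) (hq : Feasible q) :
    Feasible fun x => rowSign (p x) (q x) := by
  have h1 : Feasible fun y : γ × Bool × ℕ × ℕ => y.2.2.1 := .fst (.snd (.snd .id))
  have h2 : Feasible fun y : γ × Bool × ℕ × ℕ => y.2.2.2 := .snd (.snd (.snd .id))
  exact .foldl_bool (b := fun _ => true) (f := fun _ s (e : ℕ × ℕ) =>
    if e.1 < e.2 then false else if e.2 < e.1 then true else s) (.zip hp hq) (.const true)
    (.ite (.lt h1 h2) (.const false) (.ite (.lt h2 h1) (.const true) (.fst (.snd .id))))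

theorem feasible_colours (l : ℕ) : Feasible (colours l) := by
  have h := feasible_kernelMatrix (feasible_gram (feasible_cliques feasible_vertices
    feasible_edges l) feasible_vertices) feasible_vertices
  exact .zipWith (.fst h) (.snd h) (feasible_rowSign (.fst (.snd .id)) (.snd (.snd .id)))

theorem feasible_hasColour {V : γ → List ℕ} {C : γ → List Bool} {t : γ → List ℕ} {b : γ → Bool}
    (hV : Feasible V) (hC : Feasible C) (ht : Feasible t) (hb : Feasible b) :
    Feasible fun x => hasColour (V x) (C x) (t x) (b x) :=
  .any (.zip hV hC) (.and (.not (.xor (.snd (.snd .id)) (hb.comp (.fst .id))))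
    (.lt (.const 0) (feasible_occ (ht.comp (.fst .id)) (.fst (.snd .id)))))

theorem feasible_verify (l : ℕ) : Feasible (verify l) := by
  have hV : Feasible fun x : List Bool × List ℕ => vertices x.1 := feasible_vertices.comp (.fst .id)
  have hC : Feasible fun x : List Bool × List ℕ => colours l x.1 :=
    (feasible_colours l).comp (.fst .id)
  exact .all (feasible_cliques feasible_vertices feasible_edges l)
    (.and (feasible_hasColour hV hC (.snd .id) (.const true))
      (feasible_hasColour hV hC (.snd .id) (.const false)))

end

end CliqueColouring

/-! ### The method of Faddeev and LeVerrier for positive semidefinite matrices -/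

namespace TraceMethod

open Matrix

variable {ι : Type} [Fintype ι]

/-- The elementary symmetric polynomials. -/
def esym (x : ι → ℝ) (k : ℕ) : ℝ := ∑ t ∈ Finset.univ.powersetCard k, ∏ j ∈ t, x j

theorem esym_zero (x : ι → ℝ) : esym x 0 = 1 := by
  simp [esym]

variable [DecidableEq ι]

/-- The elementary symmetric polynomials of all but one variable. -/
def esymErase (x : ι → ℝ) (k : ℕ) (i : ι) : ℝ :=
  ∑ t ∈ (Finset.univ.erase i).powersetCard k, ∏ j ∈ t, x j

theorem esymErase_zero (x : ι → ℝ) (i : ι) : esymErase x 0 i = 1 := by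
  simp [esymErase]

/-- Split the `(k + 1)`-subsets according to whether they contain `i`. -/
theorem esym_succ (x : ι → ℝ) (k : ℕ) (i : ι) :
    esym x (k + 1) = esymErase x (k + 1) i + x i * esymErase x k i := by
  have hi : i ∉ Finset.univ.erase i := Finset.notMem_erase _ _
  have hmem : ∀ {k : ℕ} {t : Finset ι}, t ∈ (Finset.univ.erase i).powersetCard k → i ∉ t :=
    fun ht hit => hi ((Finset.mem_powersetCard.1 ht).1 hit)
  rw [esym, ← Finset.insert_erase (Finset.mem_univ i), Finset.powersetCard_succ_insert hi,
    Finset.sum_union, Finset.sum_image]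
  · rw [esymErase, esymErase, Finset.mul_sum]
    congr 1
    exact Finset.sum_congr rfl fun t ht => Finset.prod_insert (hmem ht)
  · intro s hs t ht h
    rw [← Finset.erase_insert (hmem hs), ← Finset.erase_insert (hmem ht)]
    exact congrArg (fun u => u.erase i) h
  · rw [Finset.disjoint_left]
    intro t ht ht'
    obtain ⟨s, _, rfl⟩ := Finset.mem_image.1 ht'
    exact hmem ht (Finset.mem_insert_self _ _)

/-- The summand for `i` collects the products over the `(k + 1)`-subsets containing `i`, so each
subset is counted once for each of its `k + 1` elements. This identity evaluates the traces in the
recursion. -/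
theorem sum_mul_esymErase (x : ι → ℝ) (k : ℕ) :
    ∑ i, x i * esymErase x k i = (k + 1) * esym x (k + 1) := by
  have h1 : ∀ i, x i * esymErase x k i =
      ∑ t ∈ Finset.univ.powersetCard (k + 1), if i ∈ t then ∏ j ∈ t, x j else 0 := by
    intro i
    have h2 : esymErase x (k + 1) i =
        ∑ t ∈ Finset.univ.powersetCard (k + 1), if i ∈ t then 0 else ∏ j ∈ t, x j := by
      rw [esymErase, Finset.sum_ite, Finset.sum_const_zero, zero_add]
      refine Finset.sum_congr ?_ fun _ _ => rfl
      ext t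
      simp [Finset.mem_powersetCard, Finset.subset_erase, and_comm]
    have h3 := esym_succ x k i
    rw [h2, esym] at h3
    rw [eq_sub_of_add_eq' h3.symm, ← Finset.sum_sub_distrib]
    refine Finset.sum_congr rfl fun t _ => ?_
    split <;> simp
  simp_rw [h1]
  rw [Finset.sum_comm, esym, Finset.mul_sum]
  refine Finset.sum_congr rfl fun t ht => ?_
  rw [Finset.sum_ite_mem, Finset.univ_inter, Finset.sum_const, (Finset.mem_powersetCard.1 ht).2]
  simp

variable {x : ι → ℝ}

theorem esymErase_nonneg (hx : ∀ i, 0 ≤ x i) (k : ℕ) (i : ι) : 0 ≤ esymErase x k i :=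
  Finset.sum_nonneg fun _ _ => Finset.prod_nonneg fun _ _ => hx _

/-- Any `k` of the nonzero variables form a subset that avoids `i`, and their product is a positive
summand. -/
theorem esymErase_pos (hx : ∀ i, 0 ≤ x i) {k : ℕ} {i : ι} (hi : x i = 0)
    (hk : k ≤ (Finset.univ.filter fun j => x j ≠ 0).card) : 0 < esymErase x k i := by
  obtain ⟨t, ht, hc⟩ := Finset.exists_subset_card_eq hk
  have hne : ∀ j ∈ t, x j ≠ 0 := fun j hj => (Finset.mem_filter.1 (ht hj)).2
  refine Finset.sum_pos' (fun _ _ => Finset.prod_nonneg fun _ _ => hx _)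
    ⟨t, Finset.mem_powersetCard.2 ⟨fun j hj => ?_, hc⟩,
      Finset.prod_pos fun j hj => lt_of_le_of_ne (hx j) (hne j hj).symm⟩
  rw [Finset.mem_erase]
  exact ⟨fun h => hne j hj (h ▸ hi), Finset.mem_univ _⟩

/-- If `x i` is nonzero, fewer nonzero variables remain than the product has factors. This is what
ends the recursion at the rank. -/
theorem mul_esymErase_card (x : ι → ℝ) (i : ι) :
    x i * esymErase x (Finset.univ.filter fun j => x j ≠ 0).card i = 0 := by
  by_cases hi : x i = 0
  · rw [hi, zero_mul]
  refine mul_eq_zero_of_right _ (Finset.sum_eq_zero fun t ht => ?_)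
  obtain ⟨h1, h2⟩ := Finset.mem_powersetCard.1 ht
  by_contra h
  have hsub : t ⊆ (Finset.univ.filter fun j => x j ≠ 0).erase i := fun j hj =>
    Finset.mem_erase.2 ⟨(Finset.mem_erase.1 (h1 hj)).1,
      Finset.mem_filter.2 ⟨Finset.mem_univ _, fun h0 => h (Finset.prod_eq_zero hj h0)⟩⟩
  have := Finset.card_lt_card (Finset.erase_ssubset (s := Finset.univ.filter fun j => x j ≠ 0)
    (Finset.mem_filter.2 ⟨Finset.mem_univ i, hi⟩))
  have := Finset.card_le_card hsub
  omega

theorem esymErase_eq_esym {i : ι} (hi : x i = 0) (k : ℕ) : esymErase x k i = esym x k := by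
  cases k with
  | zero => rw [esymErase_zero, esym_zero]
  | succ k => rw [esym_succ x k i, hi, zero_mul, add_zero]

/-- One step of the method; steps to a matrix with trace zero are suppressed. -/
noncomputable def step (M : Matrix ι ι ℝ) (s : Matrix ι ι ℝ × Matrix ι ι ℝ) : Matrix ι ι ℝ × Matrix ι ι ℝ :=
  (s.1 + M, if (s.1 * s.2 - (M * s.2).trace • (1 : Matrix ι ι ℝ)).trace = 0 then s.2 else
    s.1 * s.2 - (M * s.2).trace • (1 : Matrix ι ι ℝ))

/-- After sufficiently many steps, the method finds a nonzero multiple of the orthogonal projection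
onto the kernel. -/
theorem iterate_step {M : Matrix ι ι ℝ} (hM : M.PosSemidef) {y₀ : ι → ℝ} (hy₀ : y₀ ≠ 0)
    (hMy₀ : M *ᵥ y₀ = 0) {m : ℕ} (hm : Fintype.card ι ≤ m) :
    M * ((step M)^[m] (M, 1)).2 = 0 ∧
      ∃ a : ℝ, a ≠ 0 ∧ ∀ y, M *ᵥ y = 0 → ((step M)^[m] (M, 1)).2 *ᵥ y = a • y := by
  set x := hM.isHermitian.eigenvalues with hx
  have hx0 : ∀ i, 0 ≤ x i := hM.eigenvalues_nonneg
  set U : Matrix ι ι ℝ := hM.isHermitian.eigenvectorUnitary.1 with hU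
  have hUU : U * star U = 1 := Unitary.coe_mul_star_self _
  have hUU' : star U * U = 1 := Unitary.coe_star_mul_self _
  -- `D f` has eigenvalues `f` in the fixed eigenbasis of `M`. The whole iteration stays among these
  -- matrices, which reduces it to computations with eigenvalues.
  let D : (ι → ℝ) → Matrix ι ι ℝ := fun f => U * diagonal f * star U
  have hDM : M = D x := by
    have := hM.isHermitian.spectral_theorem
    rw [Unitary.conjStarAlgAut_apply] at this
    exact this
  have hDmul : ∀ f g, D f * D g = D (f * g) := by
    intro f g
    simp only [D]
    calc U * diagonal f * star U * (U * diagonal g * star U)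
        = U * diagonal f * (star U * U) * diagonal g * star U := by simp only [Matrix.mul_assoc]
      _ = _ := by
        rw [hUU', Matrix.mul_one, Matrix.mul_assoc U, diagonal_mul_diagonal]
        rfl
  have hDone : ∀ c : ℝ, c • (1 : Matrix ι ι ℝ) = D fun _ => c := by
    intro c
    have : diagonal (fun _ : ι => c) = c • (1 : Matrix ι ι ℝ) := by
      rw [smul_one_eq_diagonal]
    simp only [D, this, Matrix.mul_smul, Matrix.mul_one, Matrix.smul_mul, hUU]
  have hDsub : ∀ f g, D f - D g = D (f - g) := by
    intro f g
    simp only [D]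
    rw [← Matrix.sub_mul, ← Matrix.mul_sub, diagonal_sub]
    rfl
  have hDsmul : ∀ (c : ℝ) f, c • D f = D (c • f) := by
    intro c f
    simp only [D]
    rw [diagonal_smul, Matrix.mul_smul, Matrix.smul_mul]
  have hDtr : ∀ f, (D f).trace = ∑ i, f i := by
    intro f
    simp only [D]
    rw [Matrix.trace_mul_comm, ← Matrix.mul_assoc, hUU', Matrix.one_mul, trace_diagonal]
  have hDvec : ∀ f y, D f *ᵥ y = U *ᵥ (f * (star U *ᵥ y)) := by
    intro f y
    simp only [D]
    rw [← mulVec_mulVec, ← mulVec_mulVec]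
    congr 1
    ext i
    rw [mulVec_diagonal]
    rfl
  have hker : ∀ y, M *ᵥ y = 0 → x * (star U *ᵥ y) = 0 := by
    intro y hy
    rw [hDM, hDvec] at hy
    have := congrArg (fun z => star U *ᵥ z) hy
    simpa [mulVec_mulVec, hUU'] using this
  obtain ⟨i₀, hi₀⟩ : ∃ i, x i = 0 := by
    by_contra h
    push Not at h
    have h1 : star U *ᵥ y₀ = 0 := by
      funext i
      exact (mul_eq_zero.1 (congrFun (hker y₀ hMy₀) i)).resolve_left (h i)
    apply hy₀
    have := congrArg (fun z => U *ᵥ z) h1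
    simpa [mulVec_mulVec, hUU] using this
  set r := (Finset.univ.filter fun j => x j ≠ 0).card with hr
  -- Without the usual division, each step multiplies by `-(k + 1)`, which accumulates to this
  -- factor.
  let c : ℕ → ℝ := fun k => (-1) ^ k * k.factorial
  have hc : ∀ k, c k ≠ 0 := fun k => mul_ne_zero (pow_ne_zero _ (by norm_num))
    (Nat.cast_ne_zero.2 k.factorial_ne_zero)
  let F : ℕ → ι → ℝ := fun k => c k • esymErase x k
  have hnext : ∀ (a : ℝ) k, (a • M) * D (F k) - (M * D (F k)).trace • (1 : Matrix ι ι ℝ) =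
      D fun i => c k * (a * (x i * esymErase x k i) - (k + 1) * esym x (k + 1)) := by
    intro a k
    rw [Matrix.smul_mul, hDone]
    nth_rw 1 [hDM]
    nth_rw 1 [hDM]
    rw [hDmul, hDtr, hDsmul, hDsub]
    congr 1
    funext i
    rw [← sum_mul_esymErase]
    simp only [F, Pi.sub_apply, Pi.smul_apply, Pi.mul_apply, smul_eq_mul]
    rw [mul_sub, Finset.mul_sum]
    congr 1
    · ring
    · exact Finset.sum_congr rfl fun j _ => by ring
  -- After `m` steps the matrix is `D (F k)` with `k` the minimum of `m` and the rank `r`, whereas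
  -- the multiple of `M` keeps growing.
  have inv : ∀ m : ℕ, ((step M)^[m] (M, 1)).1 = ((m : ℝ) + 1) • M ∧
      ∃ k ≤ r, ((step M)^[m] (M, 1)).2 = D (F k) ∧ (k = m ∨ (k = r ∧ r ≤ m)) := by
    intro m
    induction m with
    | zero =>
      refine ⟨by simp, 0, Nat.zero_le _, ?_, .inl rfl⟩
      have h1 : F 0 = fun _ => (1 : ℝ) := by
        funext i
        simp [F, c, esymErase_zero]
      rw [h1, ← hDone, one_smul]
      rfl
    | succ m ih =>
      obtain ⟨h1, k, hk, h2, h3⟩ := ih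
      rw [Function.iterate_succ_apply']
      refine ⟨?_, ?_⟩
      · change ((step M)^[m] (M, 1)).1 + M = _
        rw [h1, Nat.cast_succ, add_smul ((m : ℝ) + 1), one_smul]
      simp only [step, h1, h2, hnext]
      by_cases hkr : k = r
      -- At the rank, the product with any multiple of `M` and the trace both vanish, so the next
      -- matrix would be zero. The step is suppressed from here on.
      · have h4 : ∀ i, x i * esymErase x k i = 0 := fun i => hkr ▸ mul_esymErase_card x i
        have h5 : ((k : ℝ) + 1) * esym x (k + 1) = 0 := by
          rw [← sum_mul_esymErase]
          exact Finset.sum_eq_zero fun i _ => h4 i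
        refine ⟨k, hk, if_pos ?_, .inr ⟨hkr, by omega⟩⟩
        rw [hDtr]
        exact Finset.sum_eq_zero fun i _ => by rw [h4, h5]; ring
      -- Before the rank is reached, the multiple of `M` is exactly `k + 1`, and `esym_succ` leaves
      -- only the next erased symmetric polynomial.
      · have hkm : k = m := by omega
        subst hkm
        have h4 : (fun i => c k * (((k : ℝ) + 1) * (x i * esymErase x k i) -
            ((k : ℝ) + 1) * esym x (k + 1))) = F (k + 1) := by
          funext i
          simp only [F, c, Pi.smul_apply, smul_eq_mul, esym_succ x k i, Nat.factorial_succ, pow_succ]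
          push_cast
          ring
        rw [h4]
        refine ⟨k + 1, by omega, if_neg ?_, .inl rfl⟩
        rw [hDtr]
        simp only [F, Pi.smul_apply, smul_eq_mul, ← Finset.mul_sum]
        -- The trace of the new matrix is nonzero: its summands are nonnegative up to the common
        -- factor, and the one at the zero eigenvalue `i₀` is positive. So no step is suppressed too
        -- early.
        refine mul_ne_zero (hc _) (ne_of_gt (Finset.sum_pos' (fun i _ => esymErase_nonneg hx0 _ _)
          ⟨i₀, Finset.mem_univ _, esymErase_pos hx0 hi₀ (by omega)⟩))
  obtain ⟨-, k, hk, h2, h3⟩ := inv m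
  have hrm : r ≤ m := (Finset.card_le_univ _).trans hm
  obtain rfl : k = r := by omega
  rw [h2]
  refine ⟨?_, c r * esym x r, mul_ne_zero (hc _) ?_, fun y hy => ?_⟩
  · rw [hDM, hDmul]
    have : x * F r = fun _ => 0 := by
      funext i
      have := mul_esymErase_card x i
      simp only [F, Pi.mul_apply, Pi.smul_apply, smul_eq_mul]
      rw [mul_left_comm, this, mul_zero]
    rw [this, ← hDone, zero_smul]
  · rw [← esymErase_eq_esym hi₀]
    exact ne_of_gt (esymErase_pos hx0 hi₀ le_rfl)
  · rw [hDvec]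
    -- A kernel vector has components only at zero eigenvalues, where erasing the variable changes
    -- nothing; `F r` is constant there.
    have h4 : F r * (star U *ᵥ y) = (c r * esym x r) • (star U *ᵥ y) := by
      funext i
      rcases mul_eq_zero.1 (congrFun (hker y hy) i) with h | h
      · simp [F, esymErase_eq_esym h]
      · simp [h]
    rw [h4, mulVec_smul, mulVec_mulVec, hUU, one_mulVec]

end TraceMethod

namespace CliqueColouring

open Matrix

/-! ### Matrices as lists of rows -/

section

variable {n : ℕ}

/-- The rows of a matrix. -/
def rows (A : Matrix (Fin n) (Fin n) ℕ) : List (List ℕ) := List.ofFn fun i => List.ofFn (A i)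

theorem range_map {α : Type} (f : ℕ → α) :
    (List.range n).map f = List.ofFn fun i : Fin n => f i := by
  rw [List.ofFn_eq_map, ← List.map_coe_finRange_eq_range, List.map_map]
  rfl

theorem zipWith_ofFn {α β δ : Type} (f : α → β → δ) (a : Fin n → α) (b : Fin n → β) :
    List.zipWith f (List.ofFn a) (List.ofFn b) = List.ofFn fun i => f (a i) (b i) := by
  apply List.ext_getElem <;> simp

theorem dot_ofFn (a b : Fin n → ℕ) : dot (List.ofFn a) (List.ofFn b) = ∑ i, a i * b i := by
  rw [dot, zipWith_ofFn, List.sum_ofFn]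

theorem mulRows_rows (A B : Matrix (Fin n) (Fin n) ℕ) :
    mulRows (rows A) (rows B) = rows (A * Bᵀ) := by
  simp only [mulRows, rows, List.map_ofFn]
  congr 1
  funext i
  simp only [Function.comp_apply]
  congr 1
  funext j
  exact dot_ofFn _ _

theorem addRows_rows (A B : Matrix (Fin n) (Fin n) ℕ) :
    addRows (rows A) (rows B) = rows (A + B) := by
  simp only [addRows, rows, zipWith_ofFn]
  rfl

theorem smulRows_rows (c : ℕ) (A : Matrix (Fin n) (Fin n) ℕ) :
    smulRows c (rows A) = rows (c • A) := by
  simp only [smulRows, rows, List.map_ofFn]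
  congr 1
  funext i
  simp only [Function.comp_apply, List.map_ofFn]
  rfl

theorem frob_rows (A B : Matrix (Fin n) (Fin n) ℕ) :
    frob (rows A) (rows B) = (A * Bᵀ).trace := by
  simp only [frob, rows, zipWith_ofFn, List.sum_ofFn, dot_ofFn]
  rfl

theorem identity_range : identity (List.range n) = rows (1 : Matrix (Fin n) (Fin n) ℕ) := by
  rw [identity, range_map, rows]
  congr 1
  funext i
  rw [range_map]
  congr 1
  funext j
  simp [Matrix.one_apply, Fin.ext_iff]

/-- The occurrence vectors of a list of tuples. -/
def incidence (n : ℕ) (T : List (List ℕ)) : Matrix (Fin T.length) (Fin n) ℕ :=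
  fun t i => occ T[t] i

theorem gram_range (T : List (List ℕ)) :
    gram T (List.range n) = rows ((incidence n T)ᵀ * incidence n T) := by
  rw [gram, range_map, rows]
  congr 1
  funext i
  rw [range_map]
  congr 1
  funext j
  rw [Matrix.mul_apply, ← Fin.sum_univ_fun_getElem]
  rfl

/-- The real matrix of a matrix of natural numbers. -/
abbrev toReal {m : Type} (A : Matrix m (Fin n) ℕ) : Matrix m (Fin n) ℝ := A.map (Nat.castRingHom ℝ)

theorem toReal_trace (A : Matrix (Fin n) (Fin n) ℕ) : ((A.trace : ℕ) : ℝ) = (toReal A).trace := by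
  simp [Matrix.trace]

/-- On symmetric matrices, the iteration on lists computes the iteration on real matrices. -/
theorem kernelMatrix_rows {M : Matrix (Fin n) (Fin n) ℕ} (hM : Mᵀ = M) :
    ∃ P Q : Matrix (Fin n) (Fin n) ℕ,
      kernelMatrix (rows M) (List.range n) = (rows P, rows Q) ∧
      toReal P - toReal Q = ((TraceMethod.step (toReal M))^[n] (toReal M, 1)).2 := by
  -- `mulRows` and `frob` transpose their second argument, so `P` and `Q` must remain symmetric.
  -- Products with `M` stay symmetric because `P` and `Q` also commute with `M`.
  have key : ∀ l : List ℕ, ∃ (c : ℕ) (P Q : Matrix (Fin n) (Fin n) ℕ),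
      l.foldl (fun s _ => traceStep (rows M) (identity (List.range n)) s)
        (rows M, identity (List.range n), smulRows 0 (identity (List.range n))) =
        (rows (c • M), rows P, rows Q) ∧ Pᵀ = P ∧ Qᵀ = Q ∧ M * P = P * M ∧ M * Q = Q * M ∧
      (toReal (c • M), toReal P - toReal Q) =
        (TraceMethod.step (toReal M))^[l.length] (toReal M, 1) := by
    intro l
    induction l using List.reverseRecOn with
    | nil =>
      refine ⟨1, 1, 0, ?_, by simp, by simp, by simp, by simp, ?_⟩
      · simp [identity_range, smulRows_rows]
      · simp [toReal]
    | append_singleton l a ih =>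
      obtain ⟨c, P, Q, h1, h2, h3, h4, h5, h6⟩ := ih
      have hup : ∀ P Q : Matrix (Fin n) (Fin n) ℕ, Pᵀ = P → Qᵀ = Q →
          update (rows M) (rows (1 : Matrix (Fin n) (Fin n) ℕ)) (rows (c • M)) (rows P) (rows Q) =
            rows ((c • M) * P + (M * Q).trace • (1 : Matrix (Fin n) (Fin n) ℕ)) := by
        intro P Q hP hQ
        rw [update, mulRows_rows, frob_rows, smulRows_rows, addRows_rows, hP, hQ]
      have htr : ∀ A : Matrix (Fin n) (Fin n) ℕ, frob (rows (1 : Matrix (Fin n) (Fin n) ℕ)) (rows A) = A.trace := by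
        intro A
        rw [frob_rows, Matrix.one_mul, Matrix.trace_transpose]
      have hsymm : ∀ (P : Matrix (Fin n) (Fin n) ℕ) (t : ℕ), Pᵀ = P → M * P = P * M →
          ((c • M) * P + t • (1 : Matrix (Fin n) (Fin n) ℕ))ᵀ =
            (c • M) * P + t • (1 : Matrix (Fin n) (Fin n) ℕ) := by
        intro P t hP hMP
        simp only [Matrix.smul_mul, Matrix.transpose_add, Matrix.transpose_smul,
          Matrix.transpose_mul, Matrix.transpose_one, hP, hM, hMP]
      have hcomm : ∀ (P : Matrix (Fin n) (Fin n) ℕ) (t : ℕ), M * P = P * M →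
          M * ((c • M) * P + t • (1 : Matrix (Fin n) (Fin n) ℕ)) =
            ((c • M) * P + t • (1 : Matrix (Fin n) (Fin n) ℕ)) * M := by
        intro P t hMP
        simp only [Matrix.smul_mul, Matrix.mul_add, Matrix.add_mul, Matrix.mul_smul,
          Matrix.mul_one, Matrix.one_mul]
        rw [Matrix.mul_assoc M P M, ← hMP]
      -- The trace of `M * Q` is added to the first part and that of `M * P` to the second: the
      -- exchange realises the subtracted trace of `M * (P - Q)` within the natural numbers.
      have hdiff : toReal ((c • M) * P + (M * Q).trace • (1 : Matrix (Fin n) (Fin n) ℕ)) -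
          toReal ((c • M) * Q + (M * P).trace • (1 : Matrix (Fin n) (Fin n) ℕ)) =
          toReal (c • M) * (toReal P - toReal Q) -
            (toReal M * (toReal P - toReal Q)).trace • (1 : Matrix (Fin n) (Fin n) ℝ) := by
        have e1 : ∀ A B : Matrix (Fin n) (Fin n) ℕ, toReal (A + B) = toReal A + toReal B :=
          fun A B => Matrix.map_add _ (map_add _) A B
        have e2 : ∀ A B : Matrix (Fin n) (Fin n) ℕ, toReal (A * B) = toReal A * toReal B :=
          fun A B => Matrix.map_mul
        have e3 : ∀ t : ℕ, toReal (t • (1 : Matrix (Fin n) (Fin n) ℕ)) =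
            (t : ℝ) • (1 : Matrix (Fin n) (Fin n) ℝ) := by
          intro t
          ext i j
          change ((t * (1 : Matrix (Fin n) (Fin n) ℕ) i j : ℕ) : ℝ) =
            t * (1 : Matrix (Fin n) (Fin n) ℝ) i j
          rw [Matrix.one_apply, Matrix.one_apply]
          split <;> simp
        rw [e1, e1, e3, e3, e2, e2, toReal_trace, toReal_trace, e2, e2, Matrix.mul_sub,
          Matrix.mul_sub, Matrix.trace_sub, sub_smul]
        abel
      rw [List.foldl_append, h1, List.length_append, List.length_singleton,
        Function.iterate_succ_apply', ← h6]
      simp only [List.foldl_cons, List.foldl_nil, traceStep, TraceMethod.step, identity_range,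
        hup P Q h2 h3, hup Q P h3 h2, htr, addRows_rows]
      have hadd : (c + 1) • M = c • M + M := by rw [add_smul, one_smul]
      have hadd' : toReal ((c + 1) • M) = toReal (c • M) + toReal M := by
        rw [hadd]
        exact Matrix.map_add _ (map_add _) _ _
      have hcond : ((c • M) * P + (M * Q).trace • (1 : Matrix (Fin n) (Fin n) ℕ)).trace =
          ((c • M) * Q + (M * P).trace • (1 : Matrix (Fin n) (Fin n) ℕ)).trace ↔
          (toReal (c • M) * (toReal P - toReal Q) -
            (toReal M * (toReal P - toReal Q)).trace •
              (1 : Matrix (Fin n) (Fin n) ℝ)).trace = 0 := by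
        rw [← hdiff, Matrix.trace_sub, ← toReal_trace, ← toReal_trace, sub_eq_zero, Nat.cast_inj]
      by_cases h : ((c • M) * P + (M * Q).trace • (1 : Matrix (Fin n) (Fin n) ℕ)).trace =
          ((c • M) * Q + (M * P).trace • (1 : Matrix (Fin n) (Fin n) ℕ)).trace
      · refine ⟨c + 1, P, Q, ?_, h2, h3, h4, h5, ?_⟩
        · rw [if_pos h, hadd]
        · rw [if_pos (hcond.1 h), hadd']
      · refine ⟨c + 1, (c • M) * P + (M * Q).trace • (1 : Matrix (Fin n) (Fin n) ℕ),
      (c • M) * Q + (M * P).trace • (1 : Matrix (Fin n) (Fin n) ℕ), ?_, hsymm P _ h2 h4, hsymm Q _ h3 h5, hcomm P _ h4, hcomm Q _ h5, ?_⟩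
        · rw [if_neg h, hadd]
        · rw [if_neg (mt hcond.2 h), hadd', hdiff]
  obtain ⟨c, P, Q, h1, -, -, -, -, h2⟩ := key (List.range n)
  rw [List.length_range] at h2
  exact ⟨P, Q, by rw [kernelMatrix, h1], congrArg Prod.snd h2⟩

/-- Each unequal pair of entries overwrites the sign, equal pairs keep it. The induction therefore
removes the last entry. -/
theorem rowSign_ofFn {p q : Fin n → ℕ} {j : Fin n} (hj : p j ≠ q j)
    (hlast : ∀ i, j < i → p i = q i) :
    rowSign (List.ofFn p) (List.ofFn q) = decide (q j < p j) := by
  have hz : ∀ {n : ℕ} (p q : Fin n → ℕ),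
      (List.ofFn p).zip (List.ofFn q) = List.ofFn fun i => (p i, q i) := fun p q =>
    zipWith_ofFn _ _ _
  rw [rowSign, hz]
  induction n with
  | zero => exact j.elim0
  | succ n ih =>
    rw [List.ofFn_succ_last, List.foldl_append]
    rcases Fin.eq_castSucc_or_eq_last j with ⟨i, rfl⟩ | rfl
    · have h1 := hlast (Fin.last n) (Fin.castSucc_lt_last i)
      have h2 := ih (p := fun i => p i.castSucc) (q := fun i => q i.castSucc) (j := i) hj
        fun i' hi' => hlast _ (Fin.castSucc_lt_castSucc_iff.2 hi')
      rw [h2]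
      simp [h1]
    · rcases Nat.lt_or_gt_of_ne hj with h | h
      · simp [h, h.le]
      · simp [h, h.le]

/-- In the last column where the rows of the tuple are not all zero, the entries sum to zero and
thus have both signs. In this column each row concerned has its last nonzero entry. -/
theorem exists_rowSign {l : ℕ} (P Q : Matrix (Fin n) (Fin n) ℕ) (s : Fin l → Fin n) (i₀ : Fin l)
    (hsum : ∀ j, ∑ i, (toReal P - toReal Q) (s i) j = 0)
    (hrow : (toReal P - toReal Q) (s i₀) ≠ 0) (b : Bool) :
    ∃ i, rowSign (List.ofFn (P (s i))) (List.ofFn (Q (s i))) = b := by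
  have hval : ∀ i j, (toReal P - toReal Q) i j = (P i j : ℝ) - Q i j := fun _ _ => rfl
  have hne : ∀ i j, (toReal P - toReal Q) i j ≠ 0 ↔ P i j ≠ Q i j := by
    intro i j
    rw [hval, sub_ne_zero, Ne, Nat.cast_inj]
  let J := Finset.univ.filter fun j => ∃ i, P (s i) j ≠ Q (s i) j
  obtain ⟨j₀, hj₀⟩ := Function.ne_iff.1 hrow
  have hJ : J.Nonempty := ⟨j₀, Finset.mem_filter.2 ⟨Finset.mem_univ _, i₀, (hne _ _).1 hj₀⟩⟩
  obtain ⟨-, i₁, hi₁⟩ := Finset.mem_filter.1 (J.max'_mem hJ)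
  have hlast : ∀ i j, J.max' hJ < j → P (s i) j = Q (s i) j := by
    intro i j hj
    by_contra h
    exact absurd (J.le_max' j (Finset.mem_filter.2 ⟨Finset.mem_univ _, i, h⟩)) (not_le.2 hj)
  have hex : ∃ i, (if b then 0 < (toReal P - toReal Q) (s i) (J.max' hJ) else
      (toReal P - toReal Q) (s i) (J.max' hJ) < 0) := by
    cases b with
    | true =>
      obtain ⟨i, -, hi⟩ := Finset.exists_pos_of_sum_zero_of_exists_nonzero _ (hsum (J.max' hJ))
        ⟨i₁, Finset.mem_univ _, (hne _ _).2 hi₁⟩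
      exact ⟨i, by simpa using hi⟩
    | false =>
      obtain ⟨i, -, hi⟩ := Finset.exists_pos_of_sum_zero_of_exists_nonzero
        (s := Finset.univ) (fun i => -(toReal P - toReal Q) (s i) (J.max' hJ))
        (by rw [Finset.sum_neg_distrib, hsum, neg_zero])
        ⟨i₁, Finset.mem_univ _, neg_ne_zero.2 ((hne _ _).2 hi₁)⟩
      exact ⟨i, by simpa using hi⟩
  obtain ⟨i, hi⟩ := hex
  refine ⟨i, ?_⟩
  cases b with
  | true =>
    have h1 : Q (s i) (J.max' hJ) < P (s i) (J.max' hJ) := by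
      simpa [hval] using hi
    rw [rowSign_ofFn h1.ne' (hlast i), decide_eq_true h1]
  | false =>
    have h1 : P (s i) (J.max' hJ) < Q (s i) (J.max' hJ) := by
      simpa [hval] using hi
    rw [rowSign_ofFn h1.ne (hlast i), decide_eq_false h1.le.not_gt]

end

end CliqueColouring

namespace CliqueColouring

open Matrix

/-! ### Cliques in structures -/

/-- Adjacency in a structure with one binary relation. -/
def Adj (I : FinStructure Language.graph) (u v : Fin I.size) : Prop :=
  Language.Structure.RelMap Language.adj ![u, v]

/-- The tuple `s` is a homomorphic image of a clique. -/
def IsCliqueTuple (I : FinStructure Language.graph) {l : ℕ} (s : Fin l → Fin I.size) : Prop :=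
  ∀ i j, i ≠ j → Adj I (s i) (s j)

/-- Homomorphisms from a clique are tuples with edges in both directions between distinct positions.
Vertices may repeat if they carry loops. -/
theorem isFree_cliqueFamily {c k : ℕ} {I : FinStructure Language.graph} {g : Fin I.size → Fin c} :
    IsFree (cliqueFamily c k) I g ↔
      ∀ s : Fin k → Fin I.size, IsCliqueTuple I s → ¬ ∃ a, ∀ i, g (s i) = a := by
  constructor
  · rintro h s hs ⟨a, ha⟩
    refine h ⟨cliqueStructure k, fun _ => a⟩ ⟨a, rfl⟩ ⟨s, fun f => (nomatch f), ?_⟩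
      (funext fun i => (ha i).symm)
    rintro n ⟨⟩ x hx
    have := hs (x 0) (x 1) hx
    have hx2 : s ∘ x = ![s (x 0), s (x 1)] := by
      funext i
      fin_cases i <;> rfl
    exact (congrArg (Language.Structure.RelMap Language.adj) hx2).mpr this
  · rintro h p ⟨a, rfl⟩ φ hφ
    refine h φ (fun i j hij => ?_) ⟨a, fun i => (congrFun hφ i).symm⟩
    have := φ.map_rel Language.adj ![i, j] hij
    have hx2 : φ ∘ ![i, j] = ![φ i, φ j] := by
      funext i
      fin_cases i <;> rfl
    rw [hx2] at this
    exact this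

/-- Otherwise `k` positions of the same colour would give a monochromatic image of the `k`-clique.
-/
theorem card_colour_lt {c k l : ℕ} {I : FinStructure Language.graph} {g : Fin I.size → Fin c}
    (hg : IsFree (cliqueFamily c k) I g) {s : Fin l → Fin I.size} (hs : IsCliqueTuple I s)
    (a : Fin c) : (Finset.univ.filter fun i => g (s i) = a).card < k := by
  by_contra h
  obtain ⟨t, ht, hk⟩ := Finset.exists_subset_card_eq (not_lt.1 h)
  refine isFree_cliqueFamily.1 hg (fun i => s (t.orderEmbOfFin hk i)) (fun i j hij =>
    hs _ _ fun h => hij ((t.orderEmbOfFin hk).injective h)) ⟨a, fun i => ?_⟩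
  exact (Finset.mem_filter.1 (ht (t.orderEmbOfFin_mem hk i))).2

theorem sum_card_colour {c l : ℕ} (f : Fin l → Fin c) :
    ∑ a, (Finset.univ.filter fun i => f i = a).card = l := by
  rw [← Finset.card_eq_sum_card_fiberwise fun _ _ => Finset.mem_coe.2 (Finset.mem_univ _),
    Finset.card_univ, Fintype.card_fin]

theorem size_clique_le {c k l : ℕ} {I : FinStructure Language.graph} {g : Fin I.size → Fin c}
    (hg : IsFree (cliqueFamily c k) I g) {s : Fin l → Fin I.size} (hs : IsCliqueTuple I s) :
    l ≤ c * (k - 1) := by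
  rw [← sum_card_colour fun i => g (s i)]
  refine (Finset.sum_le_card_nsmul _ _ (k - 1) fun a _ => ?_).trans (by simp)
  have := card_colour_lt hg hs a
  omega

/-- The hypothesis on `l` is the reverse of `size_clique_le`, so the pigeonhole bound is attained:
every colour occurs exactly `k - 1` times, and the sum is `k - 1` times the total weight. -/
theorem sum_colour_eq_zero {c k l : ℕ} {I : FinStructure Language.graph} {g : Fin I.size → Fin c}
    (hg : IsFree (cliqueFamily c k) I g) (hl : c * (k - 1) ≤ l) {s : Fin l → Fin I.size}
    (hs : IsCliqueTuple I s) {w : Fin c → ℝ} (hw : ∑ a, w a = 0) : ∑ i, w (g (s i)) = 0 := by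
  have hle : ∀ a ∈ (Finset.univ : Finset (Fin c)),
      (Finset.univ.filter fun i => g (s i) = a).card ≤ k - 1 := fun a _ => by
    have := card_colour_lt hg hs a
    omega
  have hsum := sum_card_colour fun i => g (s i)
  have hl' := size_clique_le hg hs
  have heq := (Finset.sum_eq_sum_iff_of_le hle).1 (by
    rw [hsum, Finset.sum_const, Finset.card_univ, Fintype.card_fin, smul_eq_mul]
    omega)
  rw [← Finset.sum_fiberwise_of_maps_to (g := fun i => g (s i))
    (t := Finset.univ) fun _ _ => Finset.mem_univ _]
  have h1 : ∀ a ∈ (Finset.univ : Finset (Fin c)),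
      ∑ i ∈ Finset.univ.filter (fun i => g (s i) = a), w (g (s i)) = ((k - 1 : ℕ) : ℝ) * w a := by
    intro a ha
    rw [← heq a ha, Finset.sum_congr rfl fun i hi => congrArg w (Finset.mem_filter.1 hi).2,
      Finset.sum_const, nsmul_eq_mul]
  rw [Finset.sum_congr rfl h1, ← Finset.mul_sum, hw, mul_zero]

/-! ### Correctness of the enumeration of cliques -/

theorem foldl_splitStep (l : List Bool) (u r : List Bool) :
    l.foldl splitStep (true, u, r) = (true, u, l.reverse ++ r) := by
  induction l generalizing r with
  | nil => rfl
  | cons b l ih => simpa [splitStep] using ih (b :: r)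

theorem foldl_splitStep_replicate (n : ℕ) (u : List Bool) :
    (List.replicate n true).foldl splitStep (false, u, []) =
      (false, List.replicate n true ++ u, []) := by
  induction n generalizing u with
  | zero => rfl
  | succ n ih =>
    rw [List.replicate_succ, List.foldl_cons]
    refine (ih (true :: u)).trans ?_
    rw [← List.singleton_append, ← List.append_assoc, ← List.replicate_succ',
      ← List.replicate_succ]

open Classical in
theorem split_encodeGraph (I : FinStructure Language.graph) :
    split (encodeGraph I) = (List.replicate I.size true,
      ((List.finRange I.size).flatMap fun i => (List.finRange I.size).map fun j =>
        decide (Adj I i j)).reverse) := by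
  rw [split, encodeGraph, List.foldl_append, foldl_splitStep_replicate, List.append_nil,
    List.foldl_cons]
  refine (congrArg Prod.snd (foldl_splitStep _ (List.replicate I.size true) [])).trans ?_
  rw [List.append_nil]
  rfl

theorem vertices_encodeGraph (I : FinStructure Language.graph) :
    vertices (encodeGraph I) = List.range I.size := by
  rw [vertices, split_encodeGraph, List.length_replicate]

theorem mem_edges (I : FinStructure Language.graph) (e : ℕ × ℕ) :
    e ∈ edges (encodeGraph I) ↔ ∃ i j : Fin I.size, Adj I i j ∧ e = (↑i, ↑j) := by
  classical
  let L := (List.finRange I.size).flatMap fun i => (List.finRange I.size).map fun j => (i, j)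
  have h1 : ((vertices (encodeGraph I)).flatMap fun u =>
      (vertices (encodeGraph I)).map fun v => (u, v)) =
      L.map fun x => ((x.1 : ℕ), (x.2 : ℕ)) := by
    rw [vertices_encodeGraph, ← List.map_coe_finRange_eq_range]
    simp only [L, List.flatMap_map, List.map_flatMap, List.map_map]
    rfl
  have h2 : (split (encodeGraph I)).2.reverse = L.map fun x => decide (Adj I x.1 x.2) := by
    rw [split_encodeGraph, List.reverse_reverse]
    simp only [L, List.map_flatMap, List.map_map]
    rfl
  rw [edges, h1, h2, List.zip_map']
  simp only [List.mem_map, List.mem_filter]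
  constructor
  · rintro ⟨_, ⟨⟨⟨i, j⟩, -, rfl⟩, h⟩, rfl⟩
    exact ⟨i, j, by simpa using h, rfl⟩
  · rintro ⟨i, j, h, rfl⟩
    exact ⟨_, ⟨⟨(i, j), by simp [L], rfl⟩, by simpa using h⟩, rfl⟩

theorem hasEdge_encodeGraph (I : FinStructure Language.graph) (i j : Fin I.size) :
    hasEdge (edges (encodeGraph I)) i j = true ↔ Adj I i j := by
  simp only [hasEdge, List.any_eq_true, Bool.and_eq_true, decide_eq_true_eq]
  constructor
  · rintro ⟨e, he, h1, h2⟩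
    obtain ⟨i', j', h, rfl⟩ := (mem_edges I e).1 he
    rwa [← Fin.ext h1, ← Fin.ext h2]
  · exact fun h => ⟨_, (mem_edges I _).2 ⟨i, j, h, rfl⟩, rfl, rfl⟩

theorem mem_cliques_iff (V : List ℕ) (E : List (ℕ × ℕ)) (l : ℕ) (t : List ℕ) :
    t ∈ cliques V E l ↔ t.length = l ∧ (∀ v ∈ t, v ∈ V) ∧
      t.Pairwise fun v u => hasEdge E u v = true ∧ hasEdge E v u = true := by
  induction l generalizing t with
  | zero =>
    rw [cliques, List.mem_singleton, List.length_eq_zero_iff]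
    constructor
    · rintro rfl
      simp
    · exact fun h => h.1
  | succ l ih =>
    simp only [cliques, List.mem_flatMap, List.mem_map, List.mem_filter, List.all_eq_true,
      Bool.and_eq_true, ih]
    constructor
    · rintro ⟨t, ⟨h1, h2, h3⟩, v, ⟨hv, h4⟩, rfl⟩
      exact ⟨by simp [h1], by simpa [hv] using h2, List.pairwise_cons.2 ⟨h4, h3⟩⟩
    · rintro ⟨h1, h2, h3⟩
      cases t with
      | nil => simp at h1
      | cons v t =>
        rw [List.pairwise_cons] at h3
        exact ⟨t, ⟨by simpa using h1, fun u hu => h2 u (List.mem_cons_of_mem _ hu), h3.2⟩, v,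
          ⟨h2 v List.mem_cons_self, h3.1⟩, rfl⟩

/-- The enumeration compares each entry with the later ones in both directions, which covers all
pairs of distinct positions. -/
theorem mem_cliques_encodeGraph (I : FinStructure Language.graph) (l : ℕ) (t : List ℕ) :
    t ∈ cliques (vertices (encodeGraph I)) (edges (encodeGraph I)) l ↔
      ∃ s : Fin l → Fin I.size, IsCliqueTuple I s ∧ t = List.ofFn fun i => (s i : ℕ) := by
  rw [mem_cliques_iff, vertices_encodeGraph]
  constructor
  · rintro ⟨rfl, h2, h3⟩
    have hlt : ∀ i : Fin t.length, t[i] < I.size := fun i =>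
      List.mem_range.1 (h2 _ (List.getElem_mem i.2))
    have ht : t = List.ofFn fun i => ((⟨t[i], hlt i⟩ : Fin I.size) : ℕ) := by
      simp
    refine ⟨fun i => ⟨t[i], hlt i⟩, fun i j hij => ?_, ht⟩
    rw [← hasEdge_encodeGraph]
    rcases lt_or_gt_of_ne hij with h | h
    · exact (List.pairwise_iff_getElem.1 h3 i j i.2 j.2 h).2
    · exact (List.pairwise_iff_getElem.1 h3 j i j.2 i.2 h).1
  · rintro ⟨s, hs, rfl⟩
    refine ⟨List.length_ofFn, fun v hv => ?_, ?_⟩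
    · obtain ⟨i, rfl⟩ := (List.mem_ofFn' _ _).1 hv
      simp
    · rw [List.pairwise_ofFn]
      exact fun i j hij => ⟨(hasEdge_encodeGraph I _ _).2 (hs j i hij.ne'),
        (hasEdge_encodeGraph I _ _).2 (hs i j hij.ne)⟩

theorem occ_ofFn {l : ℕ} (s : Fin l → ℕ) (u : ℕ) :
    occ (List.ofFn s) u = ∑ i, if s i = u then 1 else 0 := by
  rw [occ, List.map_ofFn, List.sum_ofFn]
  rfl

/-! ### Correctness of the colouring -/

/-- The colouring `C` is computed from the structure alone; the free colouring `g` enters only the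
analysis, as the source of a kernel vector without zeros. -/
theorem colours_encodeGraph (l : ℕ) (I : FinStructure Language.graph) :
    ∃ C : Fin I.size → Bool, colours l (encodeGraph I) = List.ofFn C ∧
      ∀ (c k : ℕ) (g : Fin I.size → Fin c), 2 ≤ c → 0 < l → c * (k - 1) ≤ l →
        IsFree (cliqueFamily c k) I g → ∀ s : Fin l → Fin I.size, IsCliqueTuple I s →
          ∀ b, ∃ i, C (s i) = b := by
  set T := cliques (vertices (encodeGraph I)) (edges (encodeGraph I)) l with hT
  set B := incidence I.size T with hB
  obtain ⟨P, Q, h1, h2⟩ := kernelMatrix_rows (M := Bᵀ * B)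
    (by rw [Matrix.transpose_mul, Matrix.transpose_transpose])
  refine ⟨fun i => rowSign (List.ofFn (P i)) (List.ofFn (Q i)), ?_, ?_⟩
  · rw [colours, ← hT, vertices_encodeGraph, gram_range, h1]
    exact zipWith_ofFn _ _ _
  intro c k g hc hl hkl hg s hs b
  have hMreal : toReal (Bᵀ * B) = (toReal B)ᴴ * toReal B := by
    rw [conjTranspose_eq_transpose_of_trivial]
    exact (Matrix.map_mul).trans rfl
  have hBsum : ∀ (t : Fin T.length), ∃ s : Fin l → Fin I.size, IsCliqueTuple I s ∧
      ∀ y : Fin I.size → ℝ, (toReal B *ᵥ y) t = ∑ i, y (s i) := by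
    intro t
    obtain ⟨s, hs, ht⟩ := (mem_cliques_encodeGraph I l _).1 (List.getElem_mem t.2)
    refine ⟨s, hs, fun y => ?_⟩
    have hBt : ∀ v : Fin I.size, toReal B t v = ∑ i, if s i = v then 1 else 0 := by
      intro v
      change ((occ T[t] v : ℕ) : ℝ) = _
      have : T[t] = List.ofFn fun i => (s i : ℕ) := ht
      rw [this, occ_ofFn]
      push_cast
      simp only [Fin.ext_iff]
    simp only [mulVec, dotProduct, hBt, Finset.sum_mul]
    rw [Finset.sum_comm]
    simp
  have hmem : ∀ s : Fin l → Fin I.size, IsCliqueTuple I s →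
      ∃ t : Fin T.length, ∀ y : Fin I.size → ℝ, (toReal B *ᵥ y) t = ∑ i, y (s i) := by
    intro s hs
    obtain ⟨t, ht, hts⟩ := List.getElem_of_mem ((mem_cliques_encodeGraph I l _).2 ⟨s, hs, rfl⟩)
    refine ⟨⟨t, ht⟩, fun y => ?_⟩
    have hBt : ∀ v : Fin I.size, toReal B ⟨t, ht⟩ v = ∑ i, if s i = v then 1 else 0 := by
      intro v
      change ((occ T[t] v : ℕ) : ℝ) = _
      rw [hts, occ_ofFn]
      push_cast
      simp only [Fin.ext_iff]
    simp only [mulVec, dotProduct, hBt, Finset.sum_mul]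
    rw [Finset.sum_comm]
    simp
  -- The weights sum to zero, and `2 ≤ c` makes the weight `c - 1` of the first colour nonzero as
  -- well.
  let w : Fin c → ℝ := fun a => if a = ⟨0, by omega⟩ then (c : ℝ) - 1 else -1
  have hc' : (2 : ℝ) ≤ c := by exact_mod_cast hc
  have hw : ∑ a, w a = 0 := by
    have : ∀ a, w a = (if a = ⟨0, by omega⟩ then (c : ℝ) else 0) - 1 := by
      intro a
      simp only [w]
      split <;> ring
    simp [this]
  have hw0 : ∀ a, w a ≠ 0 := by
    intro a
    simp only [w]
    split <;> linarith
  let y₀ : Fin I.size → ℝ := fun v => w (g v)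
  have hBy : toReal B *ᵥ y₀ = 0 := by
    funext t
    obtain ⟨s, hs, hy⟩ := hBsum t
    rw [hy]
    exact sum_colour_eq_zero hg hkl hs hw
  have hMy : toReal (Bᵀ * B) *ᵥ y₀ = 0 := by
    rw [hMreal, ← mulVec_mulVec, hBy, mulVec_zero]
  have hy₀ : y₀ ≠ 0 := fun h => hw0 _ (congrFun h (s ⟨0, hl⟩))
  obtain ⟨h3, a, ha, h4⟩ := TraceMethod.iterate_step (M := toReal (Bᵀ * B))
    (by rw [hMreal]; exact posSemidef_conjTranspose_mul_self _) hy₀ hMy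
    (m := I.size) (by simp)
  rw [← h2] at h3 h4
  -- A Gram matrix has the same kernel as its factor, so the columns of the computed matrix satisfy
  -- the clique equations.
  have hBN : toReal B * (toReal P - toReal Q) = 0 := by
    rw [hMreal] at h3
    exact (conjTranspose_mul_self_mul_eq_zero _ _).1 h3
  refine exists_rowSign P Q s ⟨0, hl⟩ (fun j => ?_) (fun h => ?_) b
  · obtain ⟨t, ht⟩ := hmem s hs
    rw [← ht fun v => (toReal P - toReal Q) v j]
    exact congrFun (congrFun hBN t) j
  -- A zero row at a vertex would make the corresponding entry of `a • y₀` zero, but `y₀` vanishes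
  -- nowhere.
  · have h5 := congrFun (h4 y₀ hMy) (s ⟨0, hl⟩)
    rw [mulVec, h, zero_dotProduct] at h5
    exact mul_ne_zero ha (hw0 _) h5.symm

theorem hasColour_ofFn {n l : ℕ} (C : Fin n → Bool) (s : Fin l → Fin n) (b : Bool) :
    hasColour (List.range n) (List.ofFn C) (List.ofFn fun i => (s i : ℕ)) b = true ↔
      ∃ i, C (s i) = b := by
  have hzip : (List.range n).zip (List.ofFn C) = List.ofFn fun i : Fin n => ((i : ℕ), C i) := by
    have := zipWith_ofFn (fun a b => (a, b)) (fun i : Fin n => (i : ℕ)) C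
    rwa [← range_map (fun i => i), List.map_id'] at this
  have hocc : ∀ v : Fin n, 0 < occ (List.ofFn fun i => (s i : ℕ)) v ↔ ∃ i, s i = v := by
    intro v
    rw [occ_ofFn, Finset.sum_pos_iff]
    constructor
    · rintro ⟨i, -, hi⟩
      refine ⟨i, ?_⟩
      by_contra h
      rw [if_neg fun h' => h (Fin.ext h')] at hi
      exact lt_irrefl _ hi
    · rintro ⟨i, rfl⟩
      exact ⟨i, Finset.mem_univ _, by simp⟩
  rw [hasColour, hzip, List.any_eq_true]
  constructor
  · rintro ⟨e, he, h⟩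
    obtain ⟨v, rfl⟩ := (List.mem_ofFn' _ _).1 he
    simp only [Bool.and_eq_true, decide_eq_true_eq, hocc] at h
    obtain ⟨h1, i, rfl⟩ := h
    refine ⟨i, ?_⟩
    cases b <;> simpa using h1
  · rintro ⟨i, rfl⟩
    refine ⟨_, (List.mem_ofFn' _ _).2 ⟨s i, rfl⟩, ?_⟩
    simp [hocc]

/-- The colour that is assigned to a Boolean. -/
def boolColour (d : ℕ) (hd : 0 < d) (b : Bool) : Fin d :=
  -- The minimum keeps the value in range for `d = 1`, where both Booleans get the same colour.
  if b then ⟨0, hd⟩ else ⟨min 1 (d - 1), by omega⟩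

theorem boolColour_ne {d : ℕ} (hd : 0 < d) (hd' : 2 ≤ d) :
    boolColour d hd true ≠ boolColour d hd false := by
  simp [boolColour, Fin.ext_iff]
  omega

theorem isFree_boolColour {d l : ℕ} (hd : 0 < d) (hd' : 2 ≤ d) {I : FinStructure Language.graph}
    {C : Fin I.size → Bool}
    (h : ∀ s : Fin l → Fin I.size, IsCliqueTuple I s → ∀ b, ∃ i, C (s i) = b) :
    IsFree (cliqueFamily d l) I fun v => boolColour d hd (C v) := by
  rw [isFree_cliqueFamily]
  rintro s hs ⟨a, ha⟩
  obtain ⟨i, hi⟩ := h s hs true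
  obtain ⟨j, hj⟩ := h s hs false
  have h1 := ha i
  have h2 := ha j
  rw [hi] at h1
  rw [hj] at h2
  exact boolColour_ne hd hd' (h1.trans h2.symm)

theorem isFree_of_no_clique {d l : ℕ} {I : FinStructure Language.graph}
    (h : ∀ s : Fin l → Fin I.size, ¬ IsCliqueTuple I s) (g : Fin I.size → Fin d) :
    IsFree (cliqueFamily d l) I g :=
  isFree_cliqueFamily.2 fun s hs => absurd hs (h s)

/-! ### The containment condition -/

/-- Integer form of the containment condition: `k - 1` lies below a rounded-up quotient exactly if
it lies below the quotient itself. -/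
theorem lt_of_containment {c d k l : ℕ} (hc : 0 < c) (hd : 0 < d) (hk : 0 < k)
    (h : ContainmentCondition c d k l) :
    (⌈(c : ℚ) / (d : ℚ)⌉₊) * (k - 1) < l := by
  set m := ⌈(c : ℚ) / (d : ℚ)⌉₊ with hm
  have hm0 : 0 < m := Nat.ceil_pos.2 (by positivity)
  have hm0' : (0 : ℚ) < m := by exact_mod_cast hm0
  have h1 : k - 1 < ⌈(l : ℚ) / (m : ℚ)⌉₊ := by
    have : k ≤ ⌈(l : ℚ) / (m : ℚ)⌉₊ := h
    omega
  rw [Nat.lt_ceil, lt_div_iff₀ hm0'] at h1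
  have h2 : (k - 1) * m < l := by exact_mod_cast h1
  rwa [mul_comm] at h2

theorem le_ceil_mul (c : ℕ) {d : ℕ} (hd : 0 < d) : c ≤ ⌈(c : ℚ) / (d : ℚ)⌉₊ * d := by
  have h1 := Nat.le_ceil ((c : ℚ) / (d : ℚ))
  rw [div_le_iff₀ (by exact_mod_cast hd)] at h1
  exact_mod_cast h1

/-- With equality, the containment condition says `⌈c / d⌉ < c`. This excludes `c = 1`, because the
left side is positive, and `d = 1`, where it equals `c`. -/
theorem two_le_of_containment {c d k l : ℕ} (hc : 0 < c) (hd : 0 < d) (hk : 0 < k)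
    (h : ContainmentCondition c d k l) (hl : l = c * (k - 1)) : 2 ≤ c ∧ 2 ≤ d := by
  have h1 := lt_of_containment hc hd hk h
  rw [hl] at h1
  have h2 := lt_of_mul_lt_mul_right h1 (Nat.zero_le _)
  have h3 := le_ceil_mul c hd
  have h4 : 0 < ⌈(c : ℚ) / (d : ℚ)⌉₊ := Nat.ceil_pos.2 (by positivity)
  refine ⟨by omega, ?_⟩
  by_contra h5
  have h6 : d = 1 := by omega
  rw [h6] at h2 h3
  omega

theorem recolourable_of_containment {c d k l : ℕ} (hc : 0 < c) (hd : 0 < d) (hk : 0 < k)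
    (h : ContainmentCondition c d k l) : Recolourable (cliqueFamily c k) (cliqueFamily d l) := by
  set m := ⌈(c : ℚ) / (d : ℚ)⌉₊ with hm
  have hm0 : 0 < m := Nat.ceil_pos.2 (by positivity)
  have hlt := lt_of_containment hc hd hk h
  have hcd := le_ceil_mul c hd
  rw [← hm] at hlt hcd
  -- Consecutive blocks of `m` colours are merged. A monochromatic `l`-clique would have a preimage
  -- using at most `m` colours, each at most `k - 1` times, which is too few for `l` vertices.
  refine ⟨fun i => ⟨i / m, by
    rw [Nat.div_lt_iff_lt_mul hm0, mul_comm]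
    exact i.2.trans_le hcd⟩, ?_⟩
  rintro p ⟨a, rfl⟩ ⟨g, hg, hfree⟩
  change Fin l → Fin c at g
  have hs : IsCliqueTuple (cliqueStructure l) (fun i : Fin l => i) := fun i j hij => hij
  have h1 := sum_card_colour g
  have h2 : ∀ b : Fin c, (Finset.univ.filter fun i => g i = b).card < k :=
    card_colour_lt hfree hs
  have h3 : ∀ i, (g i : ℕ) / m = a := fun i => congrArg Fin.val (congrFun hg i)
  let S := Finset.univ.filter fun b : Fin c => (b : ℕ) / m = a
  have hS : S.card ≤ m := by
    rw [← Finset.card_map Fin.valEmbedding, ← Nat.card_Ico (a * m) (a * m + m) |>.trans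
      (Nat.add_sub_cancel_left _ _)]
    refine Finset.card_le_card fun x hx => ?_
    obtain ⟨b, hb, rfl⟩ := Finset.mem_map.1 hx
    have h4 : (b : ℕ) / m = a := (Finset.mem_filter.1 hb).2
    rw [Nat.div_eq_iff hm0] at h4
    rw [Finset.mem_Ico]
    simp only [Fin.valEmbedding_apply]
    omega
  have h4 : ∑ b, (Finset.univ.filter fun i => g i = b).card =
      ∑ b ∈ S, (Finset.univ.filter fun i => g i = b).card := by
    refine (Finset.sum_subset (Finset.subset_univ S) fun b _ hb => ?_).symm
    rw [Finset.card_eq_zero, Finset.filter_eq_empty_iff]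
    rintro i - rfl
    exact hb (Finset.mem_filter.2 ⟨Finset.mem_univ _, h3 i⟩)
  have h5 : ∑ b ∈ S, (Finset.univ.filter fun i => g i = b).card ≤ S.card * (k - 1) := by
    refine (Finset.sum_le_card_nsmul _ _ (k - 1) fun b _ => ?_).trans (by simp)
    have := h2 b
    omega
  have h6 := Nat.mul_le_mul_right (k - 1) hS
  omega

/-- Whether there is no clique of size `l`. -/
def noClique (l : ℕ) (w : List Bool) : Bool := (cliques (vertices w) (edges w) l).all fun _ => false

theorem feasible_noClique (l : ℕ) : Feasible (noClique l) :=
  .all (feasible_cliques feasible_vertices feasible_edges l) (.const false)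

theorem noClique_encodeGraph (l : ℕ) (I : FinStructure Language.graph) :
    noClique l (encodeGraph I) = true ↔ ∀ s : Fin l → Fin I.size, ¬ IsCliqueTuple I s := by
  simp only [noClique, List.all_eq_true, mem_cliques_encodeGraph]
  constructor
  · exact fun h s hs => absurd (h _ ⟨s, hs, rfl⟩) (by simp)
  · rintro h _ ⟨s, hs, rfl⟩
    exact absurd hs (h s)

end CliqueColouring

/-! ### Assembly of the decision and search algorithms. -/

open CliqueColouring in
theorem mainTheorem9 (c d k l : ℕ) (hc : 0 < c) (hd : 0 < d) (hk : 0 < k) (hl : 0 < l)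
    (hcont : ContainmentCondition c d k l) (h : c * (k - 1) ≤ l) :
    Recolourable (cliqueFamily c k) (cliqueFamily d l) ∧
    (pmmsnpDecision (cliqueFamily c k) (cliqueFamily d l)).InP encodeGraph ∧
    (pmmsnpSearch (cliqueFamily c k) (cliqueFamily d l)).InP encodeGraph
      (id : List (Fin d) → List (Fin d)) := by
  refine ⟨recolourable_of_containment hc hd hk hcont, ?_, ?_⟩
  · rcases h.lt_or_eq with hlt | heq
    -- Strict inequality: yes instances contain no `l`-clique, and without one every colouring is
    -- free.
    · refine ⟨fun I => noClique l (encodeGraph I),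
        ((feasible_noClique l).cons .nil).polyTime id fun I => rfl, ?_, ?_⟩
      · rintro I ⟨g, hg⟩
        rw [noClique_encodeGraph]
        exact fun s hs => absurd (size_clique_le hg hs) (not_le.2 hlt)
      · intro I hI
        rw [← Bool.not_eq_true, noClique_encodeGraph]
        exact fun h' => hI ⟨fun _ => ⟨0, hd⟩, isFree_of_no_clique h' _⟩
    · obtain ⟨hc2, hd2⟩ := two_le_of_containment hc hd hk hcont heq.symm
      have hv : ∀ I : FinStructure Language.graph, ∃ C : Fin I.size → Bool,
          (verify l (encodeGraph I) = true ↔ ∀ s : Fin l → Fin I.size, IsCliqueTuple I s →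
            ∀ b, ∃ i, C (s i) = b) ∧
          ((∃ g : Fin I.size → Fin c, IsFree (cliqueFamily c k) I g) →
            ∀ s : Fin l → Fin I.size, IsCliqueTuple I s → ∀ b, ∃ i, C (s i) = b) := by
        intro I
        obtain ⟨C, h1, h2⟩ := colours_encodeGraph l I
        refine ⟨C, ?_, fun ⟨g, hg⟩ => h2 c k g hc2 hl h hg⟩
        simp only [verify, List.all_eq_true, mem_cliques_encodeGraph, Bool.and_eq_true]
        rw [vertices_encodeGraph, h1]
        constructor
        · intro h3 s hs b
          have := h3 _ ⟨s, hs, rfl⟩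
          rw [hasColour_ofFn, hasColour_ofFn] at this
          cases b
          · exact this.2
          · exact this.1
        · rintro h3 _ ⟨s, hs, rfl⟩
          rw [hasColour_ofFn, hasColour_ofFn]
          exact ⟨h3 s hs _, h3 s hs _⟩
      -- Acceptance exhibits a free colouring, so no instance is wrongly accepted; on yes instances
      -- the computed colouring is correct.
      refine ⟨fun I => verify l (encodeGraph I),
        ((feasible_verify l).cons .nil).polyTime id fun I => rfl, ?_, ?_⟩
      · intro I hI
        obtain ⟨C, h1, h2⟩ := hv I
        exact h1.2 (h2 hI)
      · intro I hI
        obtain ⟨C, h1, -⟩ := hv I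
        rw [← Bool.not_eq_true, h1]
        exact fun h' => hI ⟨_, isFree_boolColour hd hd2 h'⟩
  -- The same algorithm serves both cases of the search version, since for strict inequality any
  -- output of the right length is a solution on promised instances.
  · refine ⟨fun I => (colours l (encodeGraph I)).map (boolColour d hd),
      (feasible_colours l).polyTime (boolColour d hd) fun I => rfl, ?_⟩
    rintro I ⟨g, hg⟩
    obtain ⟨C, h1, h2⟩ := colours_encodeGraph l I
    refine ⟨fun v => boolColour d hd (C v), ?_,
      (congrArg (List.map (boolColour d hd)) h1).trans List.map_ofFn⟩
    rcases h.lt_or_eq with hlt | heq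
    · exact isFree_of_no_clique (fun s hs => absurd (size_clique_le hg hs) (not_le.2 hlt)) _
    · obtain ⟨hc2, hd2⟩ := two_le_of_containment hc hd hk hcont heq.symm
      exact isFree_boolColour hd hd2 (h2 c k g hc2 hl h hg)
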